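/- **Theorem 1.17.** All graphs are finite and loopless; multiple edges are allowed. A graph $G$ is *5-edge-connected* if $G-S$ is connected for every set $S$ of fewer than five edges. For $X\subseteq V(G)$, let $\partial_G(X)$ be the set of edges with one end in $X$ and the other in $V(G)\setminus X$; a *5-edge-cut* is an edge set $C=\partial_G(X)$ with $|C|=5$. A *$\mathbb{Z}_3$-boundary* is a map $\beta:V(G)\to\mathbb{Z}_3$ with $\sum_{v\in V(G)}\beta(v)=0$. For an orientation $D$ of $G$, let $\partial_D^+(v)$ and $\partial_D^-(v)$ be the sets of arcs with tail $v$ and with head $v$, respectively. Let $G$ be a 5-edge-connected graph with at most five 5-edge-cuts (counted as edge sets). Then $G$ is $\mathbb{Z}_3$-connected, i.e. for every $\mathbb{Z}_3$-boundary $\beta$ there are an orientation $D$ of $G$ and a function $f:E(G)\to\mathbb{Z}_3\setminus\{0\}$ with $$\sum_{e\in\partial_D^+(v)}f(e)-\sum_{e\in\partial_D^-(v)}f(e)=\beta(v)\quad\text{in }\mathbb{Z}_3\text{ for every }v\in V(G).$$ Moreover, for every $\mathbb{Z}_3$-boundary $\beta$, $G$ has a $\beta$-orientation, i.e. an orientation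 $D$ with $$|\partial_D^+(v)|-|\partial_D^-(v)|\equiv\beta(v)\pmod 3\quad\text{for every }v\in V(G).$$ -/

import Mathlib

open scoped Graph

namespace Graph

variable {α ε : Type*}

/-- A multigraph is connected if it has a vertex and any two of its vertices are joined by a
walk. -/
def IsConnected (G : Graph α ε) : Prop :=
  V(G).Nonempty ∧ ∀ x ∈ V(G), ∀ y ∈ V(G), Relation.ReflTransGen G.Adj x y

/-- `G` is `k`-edge-connected if `G - S` is connected for each edge set `S` with `|S| < k`. -/
def IsEdgeConnected (G : Graph α ε) (k : ℕ) : Prop :=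
  ∀ S ⊆ E(G), S.encard < k → (G.deleteEdges S).IsConnected

/-- The edge-cut `∂(X)`: the set of edges with one end in `X` and the other outside `X`. -/
def edgeCut (G : Graph α ε) (X : Set α) : Set ε :=
  {e | ∃ x ∈ X, ∃ y ∉ X, G.IsLink e x y}

/-- The edge set `C` is a `k`-edge-cut: `C = ∂(X)` for some vertex set `X`, and `|C| = k`. -/
def IsEdgeCut (G : Graph α ε) (k : ℕ) (C : Set ε) : Prop :=
  (∃ X ⊆ V(G), C = G.edgeCut X) ∧ C.encard = k

/-- An orientation of a multigraph: every edge gets a tail and a head, which are its two ends. -/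
structure Orientation (G : Graph α ε) where
  tail : E(G) → V(G)
  head : E(G) → V(G)
  isLink : ∀ e : E(G), G.IsLink e (tail e) (head e)

/-- The set of arcs with tail `v`. -/
noncomputable def Orientation.outArcs {G : Graph α ε} [Fintype E(G)] (D : G.Orientation)
    (v : V(G)) : Finset E(G) := by
  classical exact Finset.univ.filter (fun e => D.tail e = v)

/-- The set of arcs with head `v`. -/
noncomputable def Orientation.inArcs {G : Graph α ε} [Fintype E(G)] (D : G.Orientation)
    (v : V(G)) : Finset E(G) := by
  classical exact Finset.univ.filter (fun e => D.head e = v)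

/-- A `ℤ_k`-boundary: a map from the vertices to `ℤ_k` with total sum zero. -/
def IsBoundary (G : Graph α ε) [Fintype V(G)] (k : ℕ) (b : V(G) → ZMod k) : Prop :=
  ∑ v, b v = 0

/-- `G` is `ℤ_k`-connected: for every `ℤ_k`-boundary `b` there are an orientation and a nowhere
zero map `f : E(G) → ℤ_k` whose net outflow at every vertex `v` is `b v`. -/
def IsZConnected (G : Graph α ε) [Fintype V(G)] [Fintype E(G)] (k : ℕ) : Prop :=
  ∀ b : V(G) → ZMod k, G.IsBoundary k b →
    ∃ (D : G.Orientation) (f : E(G) → ZMod k), (∀ e, f e ≠ 0) ∧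
      ∀ v, ∑ e ∈ D.outArcs v, f e - ∑ e ∈ D.inArcs v, f e = b v

/-- `D` is a `b`-orientation: `d⁺(v) - d⁻(v) ≡ b v (mod 3)` for every vertex `v`. -/
def Orientation.IsBoundaryOrientation {G : Graph α ε} [Fintype E(G)] (D : G.Orientation)
    (b : V(G) → ZMod 3) : Prop :=
  ∀ v, ((D.outArcs v).card : ZMod 3) - ((D.inArcs v).card : ZMod 3) = b v

end Graph

/-! The constant function 1 turns a β-orientation into the required flow, so only orientations
matter. By posimodularity the inclusion-minimal sides of 5-edge-cuts are pairwise disjoint, and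
hence at most five vertices meet every side of every such cut (`exists_transversal`). A new root
with one preoriented arc to each of these vertices raises the degree of every proper nonempty vertex
set to at least six, while the root has degree at most five. The arcs at the root then extend to an
orientation of the whole graph by `Valid.exists_orientation`.

For degree d and required outflow b, let τ ∈ {0, ±1, ±2, ±3} be congruent to b modulo 3 and to d
modulo 2. The extension theorem demands d ≤ 4 + |τ| of the root and d ≥ 4 + |τ| of the other proper
vertex sets. In a minimal counterexample, orienting the contraction of a nontrivial set and then
extending into that set yields the stronger d ≥ 6 + |τ| (`Critical.big_of_one_lt_card`), so local
reductions are delicate at single vertices only. Lifting excludes τ = 0 (`Critical.not_zero`).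
Deleting a directed edge excludes neighbours of opposite sign, so up to reversal every τ is 1 or 2.
An exchange at the root that preserves the size then creates both signs, a contradiction
(`Critical.false_of_not_neg`). -/

/-- A multigraph with vertex set `verts` and edge set `edges`, together with a root outside `verts`
all of whose edges are oriented: `p v` arcs lead from the root to `v` and `q v` arcs from `v` to the
root. The graph without the root is to be oriented with net outflow `γ` modulo 3. -/
structure RootedNet (V E : Type*) where
  src : E → V
  dst : E → V
  edges : Finset E
  verts : Finset V
  p : V → ℤ
  q : V → ℤ
  γ : V → ℤ

/-! ### Rooted nets, their degrees and boundaries, and minimal counterexamples -/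

namespace RootedNet

variable {V E : Type*}

/-- The required net outflow of `B`, counting arcs at the root. -/
def bet (N : RootedNet V E) (B : Finset V) : ℤ := ∑ v ∈ B, (N.γ v - N.p v + N.q v)

/-- The degree of the root. -/
def rootDeg (N : RootedNet V E) : ℤ := ∑ v ∈ N.verts, (N.p v + N.q v)

/-- The net outflow of the root. -/
def rootBet (N : RootedNet V E) : ℤ := ∑ v ∈ N.verts, (N.p v - N.q v)

def size (N : RootedNet V E) : ℤ := N.verts.card + N.edges.card + N.rootDeg

/-- Exchange of the roles of arcs from and to the root. -/
def reverse (N : RootedNet V E) : RootedNet V E :=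
  { N with p := N.q, q := N.p, γ := fun v => - N.γ v }

lemma bet_reverse (N : RootedNet V E) (B : Finset V) : N.reverse.bet B = - N.bet B := by
  simp only [bet, reverse, ← Finset.sum_neg_distrib]
  exact Finset.sum_congr rfl fun _ _ => by ring

lemma rootDeg_reverse (N : RootedNet V E) : N.reverse.rootDeg = N.rootDeg := by
  simp only [rootDeg, reverse, add_comm]

lemma size_reverse (N : RootedNet V E) : N.reverse.size = N.size := by
  simp only [size, rootDeg_reverse]
  rfl

variable [DecidableEq V]

/-- `1` if `e` crosses the boundary of `B`, otherwise `0`. -/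
def cross (N : RootedNet V E) (B : Finset V) (e : E) : ℤ :=
  if (N.src e ∈ B ↔ N.dst e ∈ B) then 0 else 1

/-- The net outflow from `B` along `e` in its reference orientation. -/
def net (N : RootedNet V E) (B : Finset V) (e : E) : ℤ :=
  (if N.src e ∈ B then 1 else 0) - (if N.dst e ∈ B then 1 else 0)

/-- The number of edges crossing the boundary of `B`, not counting edges at the root. -/
def cut (N : RootedNet V E) (B : Finset V) : ℤ := ∑ e ∈ N.edges, N.cross B e

/-- The degree of `B`, counting edges at the root. -/
def deg (N : RootedNet V E) (B : Finset V) : ℤ := N.cut B + ∑ v ∈ B, (N.p v + N.q v)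

/-- The net outflow of `B` in the orientation that reverses the edges with `σ e = -1`. -/
def flow (N : RootedNet V E) (σ : E → ℤ) (B : Finset V) : ℤ := ∑ e ∈ N.edges, σ e * N.net B e

def Orientable (N : RootedNet V E) : Prop :=
  ∃ σ : E → ℤ, (∀ e, σ e = 1 ∨ σ e = -1) ∧ ∀ v ∈ N.verts, 3 ∣ N.flow σ {v} - N.γ v

/-- The inequality `d ≥ 4 + |τ|`, where `τ ∈ {0, ±1, ±2, ±3}` is congruent to `b` modulo 3 and to
`d` modulo 2. -/
def Big (d b : ℤ) : Prop := 4 ≤ d ∧ (d = 4 → b % 3 = 0) ∧ (d = 5 → b % 3 ≠ 0)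

/-- The inequality `d ≤ 4 + |τ|`, with `τ` as in `Big`. -/
def Small (d b : ℤ) : Prop := d ≤ 7 ∧ (d = 6 → b % 3 ≠ 0) ∧ (d = 7 → b % 3 = 0)

/-- The hypotheses of the extension theorem that do not concern degrees. -/
structure Frame (N : RootedNet V E) : Prop where
  closed : ∀ e ∈ N.edges, (N.src e ∈ N.verts ↔ N.dst e ∈ N.verts)
  p_nonneg : ∀ v ∈ N.verts, 0 ≤ N.p v
  q_nonneg : ∀ v ∈ N.verts, 0 ≤ N.q v
  sum_γ : 3 ∣ ∑ v ∈ N.verts, N.γ v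

/-- The hypotheses of the extension theorem; `v₀` is a vertex with `τ = 0` whose degree is not
bounded below. -/
structure Valid (N : RootedNet V E) (v₀ : V) : Prop extends N.Frame where
  root : Small N.rootDeg N.rootBet
  big : ∀ A ⊆ N.verts, A.Nonempty → A ≠ N.verts → Big (N.deg A) (N.bet A) ∨
    (A = {v₀} ∧ N.deg A % 2 = 0 ∧ N.bet A % 3 = 0)

/-- A minimal counterexample to the extension theorem. -/
structure Critical (N : RootedNet V E) : Prop where
  valid : ∃ v₀, N.Valid v₀
  not_orientable : ¬ N.Orientable
  minimal : ∀ (M : RootedNet V E) (v₀ : V), M.size < N.size → M.Valid v₀ → M.Orientable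

variable {N : RootedNet V E} {v₀ : V}

lemma cross_nonneg (N : RootedNet V E) (B : Finset V) (e : E) : 0 ≤ N.cross B e := by
  unfold cross; split_ifs <;> simp

lemma net_eq_sum (N : RootedNet V E) (B : Finset V) (e : E) :
    N.net B e = ∑ v ∈ B, N.net {v} e := by
  simp [net, Finset.sum_sub_distrib]

lemma flow_eq_sum (N : RootedNet V E) (σ : E → ℤ) (B : Finset V) :
    N.flow σ B = ∑ v ∈ B, N.flow σ {v} := by
  unfold flow
  rw [Finset.sum_comm]
  refine Finset.sum_congr rfl fun e _ => ?_
  rw [net_eq_sum, Finset.mul_sum]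

lemma Valid.flow_verts (h : N.Valid v₀) (σ : E → ℤ) : N.flow σ N.verts = 0 := by
  refine Finset.sum_eq_zero fun e he => ?_
  simp [net, h.closed e he]

lemma Valid.rootDeg_nonneg (h : N.Valid v₀) : 0 ≤ N.rootDeg :=
  Finset.sum_nonneg fun v hv => add_nonneg (h.p_nonneg v hv) (h.q_nonneg v hv)

lemma Valid.size_nonneg (h : N.Valid v₀) : 0 ≤ N.size := by
  have := h.rootDeg_nonneg
  unfold size
  positivity

lemma Critical.one_lt_card (hN : N.Critical) : 1 < N.verts.card := by
  obtain ⟨v₀, h⟩ := hN.valid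
  by_contra! hc
  refine hN.not_orientable ⟨fun _ => 1, fun _ => Or.inl rfl, fun v hv => ?_⟩
  have hS : N.verts = {v} := by
    rw [Finset.card_le_one] at hc
    exact Finset.eq_singleton_iff_unique_mem.2 ⟨hv, fun x hx => hc x hx v hv⟩
  have h1 := h.flow_verts (fun _ => 1)
  have h2 := h.sum_γ
  rw [hS] at h1 h2
  simp only [Finset.sum_singleton] at h2
  omega

lemma deg_reverse (B : Finset V) : N.reverse.deg B = N.deg B := by
  have : N.reverse.cut B = N.cut B := rfl
  rw [deg, deg, this]
  simp only [reverse, add_comm]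

lemma Valid.reverse (h : N.Valid v₀) : N.reverse.Valid v₀ where
  closed := h.closed
  p_nonneg := h.q_nonneg
  q_nonneg := h.p_nonneg
  sum_γ := by simpa [RootedNet.reverse] using h.sum_γ
  root := by
    have hb : N.reverse.rootBet = - N.rootBet := by
      simp only [rootBet, RootedNet.reverse, ← Finset.sum_neg_distrib]
      exact Finset.sum_congr rfl fun _ _ => by ring
    have := h.root
    rw [rootDeg_reverse, hb]
    unfold Small at *
    omega
  big A hA hne hAS := by
    rw [deg_reverse, bet_reverse]
    refine (h.big A hA hne hAS).imp (fun hb => ?_) fun hb => ⟨hb.1, hb.2.1, by omega⟩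
    unfold Big at *
    omega

lemma Orientable.of_reverse (h : N.reverse.Orientable) : N.Orientable := by
  obtain ⟨σ, hσ, hf⟩ := h
  refine ⟨fun e => - σ e, fun e => ?_, fun v hv => ?_⟩
  · have := hσ e
    dsimp only
    omega
  · have h1 := hf v hv
    have h2 : N.flow (fun e => - σ e) {v} = - N.reverse.flow σ {v} := by
      simp [flow, RootedNet.reverse, net]
    have h3 : N.reverse.γ v = - N.γ v := rfl
    rw [h2]
    omega

lemma Critical.reverse (hN : N.Critical) : N.reverse.Critical where
  valid := hN.valid.imp fun _ h => h.reverse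
  not_orientable h := hN.not_orientable h.of_reverse
  minimal M v₀ hM := hN.minimal M v₀ (by rwa [size_reverse] at hM)

/-! ### Contraction of a vertex set -/

/-- Contraction of the vertex set `A` into its member `a`. -/
def contract (N : RootedNet V E) (A : Finset V) (a : V) : RootedNet V E where
  src e := if N.src e ∈ A then a else N.src e
  dst e := if N.dst e ∈ A then a else N.dst e
  edges := N.edges
  verts := insert a (N.verts \ A)
  p v := if v = a then ∑ w ∈ A, N.p w else N.p v
  q v := if v = a then ∑ w ∈ A, N.q w else N.q v
  γ v := if v = a then ∑ w ∈ A, N.γ w else N.γ v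

section Contract

variable {A B : Finset V} {a : V}

/-- The preimage of `B` under the contraction of `A` into `a`. -/
def pull (A : Finset V) (a : V) (B : Finset V) : Finset V := if a ∈ B then B ∪ A else B

/-- Crossing, net outflow and degree depend only on membership of ends, so this transfers each of
them from the contraction to `pull`. The hypothesis on `B` rules out members of `A` other than `a`,
which are no longer vertices. -/
lemma mem_pull (hB : B ⊆ (N.contract A a).verts) (x : V) :
    (if x ∈ A then a else x) ∈ B ↔ x ∈ pull A a B := by
  have := @hB x
  simp only [contract, Finset.mem_insert, Finset.mem_sdiff] at this
  unfold pull
  split_ifs with h1 h2 h2 <;> grind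

lemma sum_pull (ha : a ∈ A) (hB : B ⊆ (N.contract A a).verts) (g : V → ℤ) :
    ∑ v ∈ B, (if v = a then ∑ w ∈ A, g w else g v) = ∑ v ∈ pull A a B, g v := by
  unfold pull
  split_ifs with h
  · have hd : Disjoint (B.erase a) A := by
      rw [Finset.disjoint_left]
      intro x hx
      have := hB (Finset.mem_of_mem_erase hx)
      simp only [contract, Finset.mem_insert, Finset.mem_sdiff] at this
      have := Finset.ne_of_mem_erase hx
      tauto
    have hu : B ∪ A = B.erase a ∪ A := by
      ext x; simp only [Finset.mem_union, Finset.mem_erase]; grind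
    rw [hu, Finset.sum_union hd, ← Finset.add_sum_erase _ _ h, if_pos rfl, add_comm]
    congr 1
    exact Finset.sum_congr rfl fun x hx => if_neg (Finset.ne_of_mem_erase hx)
  · exact Finset.sum_congr rfl fun x hx => if_neg (by rintro rfl; exact h hx)

lemma net_contract (hB : B ⊆ (N.contract A a).verts) (e : E) :
    (N.contract A a).net B e = N.net (pull A a B) e := by
  simp only [net, ← mem_pull hB]
  rfl

lemma flow_contract (hB : B ⊆ (N.contract A a).verts) (σ : E → ℤ) :
    (N.contract A a).flow σ B = N.flow σ (pull A a B) := by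
  simp only [flow, net_contract hB]
  rfl

lemma cut_contract (hB : B ⊆ (N.contract A a).verts) :
    (N.contract A a).cut B = N.cut (pull A a B) := by
  simp only [cut, cross, ← mem_pull hB]
  rfl

lemma deg_contract (ha : a ∈ A) (hB : B ⊆ (N.contract A a).verts) :
    (N.contract A a).deg B = N.deg (pull A a B) := by
  simp only [deg, cut_contract hB, Finset.sum_add_distrib]
  simp only [← sum_pull ha hB]
  rfl

lemma bet_contract (ha : a ∈ A) (hB : B ⊆ (N.contract A a).verts) :
    (N.contract A a).bet B = N.bet (pull A a B) := by
  simp only [bet, Finset.sum_add_distrib, Finset.sum_sub_distrib]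
  simp only [← sum_pull ha hB]
  rfl

lemma pull_verts (ha : a ∈ A) (hA : A ⊆ N.verts) : pull A a (N.contract A a).verts = N.verts := by
  unfold pull contract
  simp only [Finset.mem_insert_self, if_true]
  ext x
  have := @hA x
  simp only [Finset.mem_union, Finset.mem_insert, Finset.mem_sdiff]
  grind

lemma pull_eq_verts (ha : a ∈ A) (hB : B ⊆ (N.contract A a).verts)
    (h : pull A a B = N.verts) (hA : A ⊆ N.verts) : B = (N.contract A a).verts := by
  refine hB.antisymm fun x hx => ?_
  have haB : a ∈ B := by
    by_contra haB
    rw [pull, if_neg haB] at h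
    exact haB (h ▸ hA ha)
  simp only [contract, Finset.mem_insert, Finset.mem_sdiff] at hx
  rw [pull, if_pos haB, Finset.ext_iff] at h
  have := h x
  grind

/-- A set in the contraction has the degree and boundary of its preimage. The exception `{v₀}`
causes no trouble: as `A` has two members, a preimage equal to `{v₀}` cannot involve `A`. -/
lemma Valid.contract (h : N.Valid v₀) (ha : a ∈ A) (hA : A ⊆ N.verts) (hA1 : 1 < A.card) :
    (N.contract A a).Valid v₀ where
  closed e he := by
    have := h.closed e he
    have h1 := mem_pull (N := N) (A := A) (a := a) subset_rfl (N.src e)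
    have h2 := mem_pull (N := N) (A := A) (a := a) subset_rfl (N.dst e)
    rw [pull_verts ha hA] at h1 h2
    exact h1.trans (this.trans h2.symm)
  p_nonneg v hv := by
    simp only [RootedNet.contract, Finset.mem_insert, Finset.mem_sdiff] at hv ⊢
    split_ifs with hva
    · exact Finset.sum_nonneg fun w hw => h.p_nonneg w (hA hw)
    · exact h.p_nonneg v (by tauto)
  q_nonneg v hv := by
    simp only [RootedNet.contract, Finset.mem_insert, Finset.mem_sdiff] at hv ⊢
    split_ifs with hva
    · exact Finset.sum_nonneg fun w hw => h.q_nonneg w (hA hw)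
    · exact h.q_nonneg v (by tauto)
  sum_γ := by
    have := h.sum_γ
    rw [← pull_verts ha hA, ← sum_pull ha subset_rfl] at this
    exact this
  root := by
    have hd : (N.contract A a).rootDeg = N.rootDeg := by
      simp only [rootDeg, Finset.sum_add_distrib]
      rw [← pull_verts ha hA]
      simp only [← sum_pull ha subset_rfl]
      rfl
    have hb : (N.contract A a).rootBet = N.rootBet := by
      simp only [rootBet, Finset.sum_sub_distrib]
      rw [← pull_verts ha hA]
      simp only [← sum_pull ha subset_rfl]
      rfl
    rw [hd, hb]
    exact h.root
  big B hB hne hBS := by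
    have hsub : pull A a B ⊆ N.verts := by
      intro x hx
      rw [← mem_pull hB] at hx
      by_cases hxA : x ∈ A
      · exact hA hxA
      · rw [if_neg hxA] at hx
        have := hB hx
        simp only [RootedNet.contract, Finset.mem_insert, Finset.mem_sdiff] at this
        grind
    have hBpull : B ⊆ pull A a B := by
      unfold pull
      split_ifs
      · exact Finset.subset_union_left
      · rfl
    rw [deg_contract ha hB, bet_contract ha hB]
    refine (h.big _ hsub (hne.mono hBpull) fun he => hBS (pull_eq_verts ha hB he hA)).imp_right
      fun he => ⟨?_, he.2⟩
    obtain ⟨he, -⟩ := he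
    unfold pull at he
    split_ifs at he with haB
    · have := Finset.card_le_card (Finset.subset_union_right (s₁ := B) (s₂ := A))
      rw [he, Finset.card_singleton] at this
      omega
    · exact he

lemma size_contract_lt (ha : a ∈ A) (hA : A ⊆ N.verts) (hA1 : 1 < A.card) :
    (N.contract A a).size < N.size := by
  have hd : (N.contract A a).rootDeg = N.rootDeg := by
    simp only [rootDeg, Finset.sum_add_distrib]
    rw [← pull_verts ha hA]
    simp only [← sum_pull ha subset_rfl]
    rfl
  have hc : (N.contract A a).verts.card < N.verts.card := by
    have h1 := Finset.card_insert_le a (N.verts \ A)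
    have h2 := Finset.card_sdiff_add_card_eq_card hA
    simp only [RootedNet.contract]
    omega
  have he : (N.contract A a).edges = N.edges := rfl
  unfold size
  rw [hd, he]
  omega

/-- In a minimal counterexample a contraction of two or more vertices can be oriented. -/
lemma Critical.exists_flow_contract (hN : N.Critical) (ha : a ∈ A) (hA : A ⊆ N.verts)
    (hA1 : 1 < A.card) : ∃ σ : E → ℤ, (∀ e, σ e = 1 ∨ σ e = -1) ∧
      ∀ v ∈ N.verts, v ∉ A → 3 ∣ N.flow σ {v} - N.γ v := by
  obtain ⟨v₀, h⟩ := hN.valid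
  obtain ⟨σ, hσ, hf⟩ := hN.minimal _ v₀ (size_contract_lt ha hA hA1) (h.contract ha hA hA1)
  refine ⟨σ, hσ, fun v hv hvA => ?_⟩
  have hva : v ≠ a := by rintro rfl; exact hvA ha
  have hv' : v ∈ (N.contract A a).verts := by simp [RootedNet.contract, hv, hvA]
  have h1 := hf v hv'
  rw [flow_contract (by simpa using hv'), pull, if_neg (by simpa using hva.symm)] at h1
  simpa [RootedNet.contract, hva] using h1

end Contract

/-! ### Restriction to a vertex set, and gluing of orientations -/

section Restrict

variable {A B : Finset V} {σ : E → ℤ}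

/-- The net on `A` obtained by contraction of all other vertices into the root, where the edges at
`A` are oriented by `σ`. -/
def restrict (N : RootedNet V E) (A : Finset V) (σ : E → ℤ) : RootedNet V E where
  src := N.src
  dst := N.dst
  edges := N.edges.filter fun e => (N.src e ∈ A ↔ N.dst e ∈ A)
  verts := A
  -- A boundary edge becomes an arc from the root to its head or from its tail to the root. Its end
  -- outside `A` also receives a value, which is irrelevant because only vertices of `A` remain.
  p v := N.p v + ∑ e ∈ N.edges with ¬ (N.src e ∈ A ↔ N.dst e ∈ A),
    if σ e = 1 then (if N.dst e = v then 1 else 0) else (if N.src e = v then 1 else 0)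
  q v := N.q v + ∑ e ∈ N.edges with ¬ (N.src e ∈ A ↔ N.dst e ∈ A),
    if σ e = 1 then (if N.src e = v then 1 else 0) else (if N.dst e = v then 1 else 0)
  γ v := N.γ v - ∑ e ∈ N.edges with ¬ (N.src e ∈ A ↔ N.dst e ∈ A), σ e * N.net {v} e

/-- The outflow along boundary edges that is subtracted from `γ` returns through the new root arcs.
-/
lemma sum_restrict (hσ : ∀ e, σ e = 1 ∨ σ e = -1) (v : V) :
    (N.restrict A σ).γ v - (N.restrict A σ).p v + (N.restrict A σ).q v =
      N.γ v - N.p v + N.q v := by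
  have : ∑ e ∈ N.edges with ¬ (N.src e ∈ A ↔ N.dst e ∈ A), σ e * N.net {v} e =
      ∑ e ∈ N.edges with ¬ (N.src e ∈ A ↔ N.dst e ∈ A),
        ((if σ e = 1 then (if N.src e = v then 1 else 0) else (if N.dst e = v then 1 else 0)) -
        (if σ e = 1 then (if N.dst e = v then 1 else 0) else (if N.src e = v then 1 else 0))) := by
    refine Finset.sum_congr rfl fun e _ => ?_
    rcases hσ e with h | h <;> simp [h, net]
  simp only [restrict]
  rw [this, Finset.sum_sub_distrib]
  ring

lemma bet_restrict (hσ : ∀ e, σ e = 1 ∨ σ e = -1) : (N.restrict A σ).bet B = N.bet B :=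
  Finset.sum_congr rfl fun v _ => sum_restrict hσ v

lemma sum_root_restrict (hB : B ⊆ A) :
    ∑ v ∈ B, ((N.restrict A σ).p v + (N.restrict A σ).q v) = ∑ v ∈ B, (N.p v + N.q v) +
      ∑ e ∈ N.edges with ¬ (N.src e ∈ A ↔ N.dst e ∈ A), N.cross B e := by
  have h1 : ∀ v, (N.restrict A σ).p v + (N.restrict A σ).q v = N.p v + N.q v +
      ∑ e ∈ N.edges with ¬ (N.src e ∈ A ↔ N.dst e ∈ A),
        ((if N.src e = v then (1 : ℤ) else 0) + if N.dst e = v then 1 else 0) := by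
    intro v
    simp only [restrict]
    have : ∀ x y z w : ℤ, x + z + (y + w) = x + y + (z + w) := by intros; ring
    rw [this, ← Finset.sum_add_distrib]
    congr 1
    refine Finset.sum_congr rfl fun e _ => ?_
    by_cases h : σ e = 1 <;> simp [h, add_comm]
  rw [Finset.sum_congr rfl fun v _ => h1 v, Finset.sum_add_distrib, Finset.sum_comm]
  congr 1
  refine Finset.sum_congr rfl fun e he => ?_
  have h2 := (Finset.mem_filter.1 he).2
  simp only [Finset.sum_add_distrib, Finset.sum_ite_eq, cross]
  by_cases h5 : N.src e ∈ B <;> by_cases h6 : N.dst e ∈ B <;> simp [h5, h6]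
  exact h2 (by simp [hB h5, hB h6])

lemma deg_restrict (hB : B ⊆ A) : (N.restrict A σ).deg B = N.deg B := by
  have h1 : N.cut B = (N.restrict A σ).cut B +
      ∑ e ∈ N.edges with ¬ (N.src e ∈ A ↔ N.dst e ∈ A), N.cross B e :=
    (Finset.sum_filter_add_sum_filter_not _ _ _).symm
  unfold deg
  rw [sum_root_restrict hB, h1]
  ring

lemma rootDeg_restrict : (N.restrict A σ).rootDeg = N.deg A := by
  rw [← deg_restrict (σ := σ) subset_rfl, deg]
  have : (N.restrict A σ).cut A = 0 := by
    refine Finset.sum_eq_zero fun e he => ?_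
    have := (Finset.mem_filter.1 he).2
    simp only [cross, restrict]
    exact if_pos this
  rw [this, zero_add]
  rfl

/-- Each boundary edge is traded for one arc at the root, and at least one vertex disappears. -/
lemma size_restrict_lt (h : N.Valid v₀) (hA : A ⊂ N.verts) : (N.restrict A σ).size < N.size := by
  have h1 := Finset.card_lt_card hA
  have h2 : (N.restrict A σ).rootDeg = ∑ v ∈ A, (N.p v + N.q v) +
      ∑ e ∈ N.edges with ¬ (N.src e ∈ A ↔ N.dst e ∈ A), N.cross A e :=
    sum_root_restrict subset_rfl
  have h3 : ∑ e ∈ N.edges with ¬ (N.src e ∈ A ↔ N.dst e ∈ A), N.cross A e ≤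
      (N.edges.filter fun e => ¬ (N.src e ∈ A ↔ N.dst e ∈ A)).card := by
    rw [Finset.cast_card]
    refine Finset.sum_le_sum fun e _ => ?_
    unfold cross
    split_ifs <;> simp
  have h4 := Finset.card_filter_add_card_filter_not (s := N.edges)
    (fun e => (N.src e ∈ A ↔ N.dst e ∈ A))
  have h5 : ∑ v ∈ A, (N.p v + N.q v) ≤ N.rootDeg :=
    Finset.sum_le_sum_of_subset_of_nonneg hA.1 fun v hv _ =>
      add_nonneg (h.p_nonneg v hv) (h.q_nonneg v hv)
  have h6 : (N.restrict A σ).verts = A := rfl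
  have h7 : (N.restrict A σ).edges = N.edges.filter fun e => (N.src e ∈ A ↔ N.dst e ∈ A) := rfl
  unfold size
  rw [h2, h6, h7]
  omega

/-- An orientation with the required net outflow outside `A` leads to one of the whole minimal
counterexample if the degree of `A` is small. -/
lemma Critical.not_small (hN : N.Critical) (hA : A ⊂ N.verts) (hσ : ∀ e, σ e = 1 ∨ σ e = -1)
    (hf : ∀ v ∈ N.verts, v ∉ A → 3 ∣ N.flow σ {v} - N.γ v) : ¬ Small (N.deg A) (N.bet A) := by
  intro hs
  obtain ⟨v₀, h⟩ := hN.valid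
  have hsum : 3 ∣ ∑ v ∈ A, (N.restrict A σ).γ v := by
    have h1 : ∑ v ∈ A, (N.restrict A σ).γ v = ∑ v ∈ A, (N.γ v - N.flow σ {v}) := by
      have h2 : ∑ v ∈ A, N.flow σ {v} = ∑ v ∈ A,
          ∑ e ∈ N.edges with ¬ (N.src e ∈ A ↔ N.dst e ∈ A), σ e * N.net {v} e := by
        rw [← flow_eq_sum, Finset.sum_comm]
        simp only [← Finset.mul_sum, ← net_eq_sum]
        symm
        refine Finset.sum_filter_of_ne fun e _ he hh => he ?_
        simp [net, hh]
      rw [Finset.sum_sub_distrib, h2, ← Finset.sum_sub_distrib]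
      rfl
    have h2 : 3 ∣ ∑ v ∈ N.verts \ A, (N.γ v - N.flow σ {v}) := by
      refine Finset.dvd_sum fun v hv => ?_
      rw [Finset.mem_sdiff] at hv
      have := hf v hv.1 hv.2
      omega
    have h3 := Finset.sum_sdiff (f := fun v => N.γ v - N.flow σ {v}) hA.1
    have h4 := h.sum_γ
    have h5 := h.flow_verts σ
    rw [flow_eq_sum] at h5
    rw [Finset.sum_sub_distrib (s := N.verts), h5] at h3
    rw [h1]
    omega
  have hvalid : (N.restrict A σ).Valid v₀ :=
    { closed := fun e he => (Finset.mem_filter.1 he).2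
      p_nonneg := fun v hv => add_nonneg (h.p_nonneg v (hA.1 hv)) <|
        Finset.sum_nonneg fun e _ => by split_ifs <;> simp
      q_nonneg := fun v hv => add_nonneg (h.q_nonneg v (hA.1 hv)) <|
        Finset.sum_nonneg fun e _ => by split_ifs <;> simp
      sum_γ := hsum
      root := by
        -- The new root has the degree of `A` and, modulo 3, the opposite boundary, hence the same
        -- |τ|.
        have h1 : (N.restrict A σ).rootBet = ∑ v ∈ A, (N.restrict A σ).γ v - N.bet A := by
          rw [← bet_restrict hσ, bet, ← Finset.sum_sub_distrib]
          exact Finset.sum_congr rfl fun v _ => by ring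
        rw [rootDeg_restrict, h1]
        unfold Small at *
        omega
      big := fun B hB hne hBA => by
        rw [deg_restrict (A := A) hB, bet_restrict hσ]
        exact h.big B (hB.trans hA.1) hne fun he => hA.2 (he ▸ hB) }
  obtain ⟨ρ, hρ, hfρ⟩ := hN.minimal _ v₀ (size_restrict_lt h hA) hvalid
  refine hN.not_orientable ⟨fun e => if N.src e ∈ A ∧ N.dst e ∈ A then ρ e else σ e,
    fun e => ?_, fun v hv => ?_⟩
  · dsimp only
    split_ifs
    exacts [hρ e, hσ e]
  by_cases hvA : v ∈ A
  · have h1 : N.flow (fun e => if N.src e ∈ A ∧ N.dst e ∈ A then ρ e else σ e) {v} =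
        (N.restrict A σ).flow ρ {v} +
          ∑ e ∈ N.edges with ¬ (N.src e ∈ A ↔ N.dst e ∈ A), σ e * N.net {v} e := by
      unfold flow
      rw [← Finset.sum_filter_add_sum_filter_not N.edges
        (fun e => (N.src e ∈ A ↔ N.dst e ∈ A))]
      congr 1
      · refine Finset.sum_congr rfl fun e he => ?_
        have he := (Finset.mem_filter.1 he).2
        by_cases hs : N.src e ∈ A
        · simp only [hs, he.1 hs, and_self, if_true]
          rfl
        · have hd : N.dst e ∉ A := fun hd => hs (he.2 hd)
          have h1 : N.src e ≠ v := by rintro rfl; exact hs hvA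
          have h2 : N.dst e ≠ v := by rintro rfl; exact hd hvA
          simp [net, restrict, h1, h2]
      · refine Finset.sum_congr rfl fun e he => ?_
        have he := (Finset.mem_filter.1 he).2
        dsimp only
        rw [if_neg (by tauto)]
    have h2 := hfρ v hvA
    have h3 : (N.restrict A σ).γ v = N.γ v -
      ∑ e ∈ N.edges with ¬ (N.src e ∈ A ↔ N.dst e ∈ A), σ e * N.net {v} e := rfl
    rw [h1]
    omega
  · have h1 : N.flow (fun e => if N.src e ∈ A ∧ N.dst e ∈ A then ρ e else σ e) {v} =
        N.flow σ {v} := by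
      refine Finset.sum_congr rfl fun e _ => ?_
      dsimp only
      split_ifs with hh
      · have h1 : N.src e ≠ v := by rintro rfl; exact hvA hh.1
        have h2 : N.dst e ≠ v := by rintro rfl; exact hvA hh.2
        simp [net, h1, h2]
      · rfl
    rw [h1]
    exact hf v hv hvA

/-- In a minimal counterexample the degree of a nontrivial vertex set is not critical. -/
lemma Critical.big_of_one_lt_card (hN : N.Critical) (hA : A ⊂ N.verts) (hA1 : 1 < A.card) :
    Big (N.deg A - 2) (N.bet A) := by
  obtain ⟨v₀, h⟩ := hN.valid
  have hne : A.Nonempty := Finset.card_pos.1 (by omega)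
  obtain ⟨a, ha⟩ := hne
  obtain ⟨σ, hσ, hf⟩ := hN.exists_flow_contract ha hA.1 hA1
  have h1 := hN.not_small hA hσ hf
  have h2 : Big (N.deg A) (N.bet A) := by
    refine (h.big A hA.1 ⟨a, ha⟩ hA.ne).resolve_right ?_
    rintro ⟨rfl, -⟩
    simp at hA1
  -- Degree and τ have equal parity, so failure of d ≤ 4 + |τ| gives d ≥ 6 + |τ|.
  unfold Small at h1
  unfold Big at *
  omega

end Restrict

end RootedNet

/-! ### Local operations: changing root arcs, deleting and lifting edges -/

namespace RootedNet

variable {V E : Type*} {N : RootedNet V E} {v₀ x y : V} {e : E}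

/-- The edge `e` has ends `x` and `y`. -/
def Joins (N : RootedNet V E) (e : E) (x y : V) : Prop :=
  (N.src e = x ∧ N.dst e = y) ∨ (N.src e = y ∧ N.dst e = x)

lemma Joins.symm (h : N.Joins e x y) : N.Joins e y x := Or.symm h

variable [DecidableEq V] {B : Finset V}

lemma Joins.cross_eq (h : N.Joins e x y) (B : Finset V) :
    N.cross B e = if (x ∈ B ↔ y ∈ B) then 0 else 1 := by
  rcases h with ⟨rfl, rfl⟩ | ⟨rfl, rfl⟩
  · rfl
  · simp only [cross, Iff.comm]

lemma Joins.exists_net_eq (h : N.Joins e x y) : ∃ c : ℤ, (c = 1 ∨ c = -1) ∧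
    ∀ B, N.net B e = c * ((if x ∈ B then 1 else 0) - (if y ∈ B then 1 else 0)) := by
  rcases h with ⟨rfl, rfl⟩ | ⟨rfl, rfl⟩
  · exact ⟨1, Or.inl rfl, fun B => by simp [net]⟩
  · exact ⟨-1, Or.inr rfl, fun B => by simp [net]⟩

lemma exists_joins_of_cross_ne_zero (h : N.cross B e ≠ 0) : ∃ x ∈ B, ∃ y ∉ B, N.Joins e x y := by
  unfold cross at h
  by_cases h1 : N.src e ∈ B <;> by_cases h2 : N.dst e ∈ B <;> simp [h1, h2] at h
  · exact ⟨_, h1, _, h2, Or.inl ⟨rfl, rfl⟩⟩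
  · exact ⟨_, h2, _, h1, Or.inr ⟨rfl, rfl⟩⟩

lemma Frame.mem_of_joins (h : N.Frame) (he : e ∈ N.edges) (hj : N.Joins e x y)
    (hx : x ∈ N.verts) : y ∈ N.verts := by
  have := h.closed e he
  rcases hj with ⟨rfl, rfl⟩ | ⟨rfl, rfl⟩ <;> tauto

/-- The net outflow has to be checked at all vertices but one. -/
lemma Valid.orientable (h : N.Valid v₀) {σ : E → ℤ} (hσ : ∀ e, σ e = 1 ∨ σ e = -1)
    {u : V} (hu : u ∈ N.verts)
    (hf : ∀ v ∈ N.verts, v ≠ u → 3 ∣ N.flow σ {v} - N.γ v) : N.Orientable := by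
  refine ⟨σ, hσ, fun v hv => ?_⟩
  by_cases hvu : v = u
  · subst hvu
    have h1 := h.flow_verts σ
    have h2 := h.sum_γ
    rw [flow_eq_sum, ← Finset.add_sum_erase _ _ hu] at h1
    rw [← Finset.add_sum_erase _ _ hu] at h2
    have h3 : 3 ∣ ∑ w ∈ N.verts.erase v, (N.flow σ {w} - N.γ w) :=
      Finset.dvd_sum fun w hw => hf w (Finset.mem_of_mem_erase hw) (Finset.ne_of_mem_erase hw)
    rw [Finset.sum_sub_distrib] at h3
    omega
  · exact hf v hv hvu

/-- Oriented arcs at the root are added at `v`, namely `c` from the root and `d` to the root. -/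
def addArcs (N : RootedNet V E) (v : V) (c d : ℤ) : RootedNet V E :=
  { N with
    p := fun w => N.p w + if w = v then c else 0
    q := fun w => N.q w + if w = v then d else 0 }

section AddArcs

variable {v : V} {c d : ℤ}

lemma deg_addArcs : (N.addArcs v c d).deg B = N.deg B + if v ∈ B then c + d else 0 := by
  have : (N.addArcs v c d).cut B = N.cut B := rfl
  rw [deg, deg, this]
  simp only [addArcs, Finset.sum_add_distrib, Finset.sum_ite_eq']
  split_ifs <;> ring

lemma bet_addArcs : (N.addArcs v c d).bet B = N.bet B + if v ∈ B then d - c else 0 := by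
  simp only [bet, addArcs, Finset.sum_add_distrib, Finset.sum_sub_distrib, Finset.sum_ite_eq']
  split_ifs <;> ring

lemma rootDeg_addArcs (hv : v ∈ N.verts) :
    (N.addArcs v c d).rootDeg = N.rootDeg + (c + d) := by
  simp only [rootDeg, addArcs, Finset.sum_add_distrib, Finset.sum_ite_eq', if_pos hv]
  ring

lemma rootBet_addArcs (hv : v ∈ N.verts) :
    (N.addArcs v c d).rootBet = N.rootBet + (c - d) := by
  simp only [rootBet, addArcs, Finset.sum_add_distrib, Finset.sum_sub_distrib,
    Finset.sum_ite_eq', if_pos hv]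
  ring

lemma size_addArcs (hv : v ∈ N.verts) : (N.addArcs v c d).size = N.size + (c + d) := by
  have h1 : (N.addArcs v c d).verts = N.verts := rfl
  have h2 : (N.addArcs v c d).edges = N.edges := rfl
  unfold size
  rw [rootDeg_addArcs hv, h1, h2]
  ring

lemma Frame.addArcs (h : N.Frame) (hc : 0 ≤ N.p v + c) (hd : 0 ≤ N.q v + d) :
    (N.addArcs v c d).Frame where
  closed := h.closed
  p_nonneg w hw := by
    have := h.p_nonneg w hw
    simp only [RootedNet.addArcs]
    split_ifs with hwv
    · rwa [hwv]
    · simpa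
  q_nonneg w hw := by
    have := h.q_nonneg w hw
    simp only [RootedNet.addArcs]
    split_ifs with hwv
    · rwa [hwv]
    · simpa
  sum_γ := h.sum_γ

/-- Root arcs enter only the hypotheses of the extension theorem, not orientability, so they may be
exchanged as long as those hypotheses survive. -/
lemma Orientable.of_addArcs (h : (N.addArcs v c d).Orientable) : N.Orientable := h

end AddArcs

variable [DecidableEq E]

/-- The edge `e` is oriented from `x` to `y` and deleted. -/
def delete (N : RootedNet V E) (e : E) (x y : V) : RootedNet V E :=
  { N with
    edges := N.edges.erase e
    γ := fun w => N.γ w - (if w = x then 1 else 0) + (if w = y then 1 else 0) }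

section Delete

lemma deg_delete (he : e ∈ N.edges) (hj : N.Joins e x y) :
    (N.delete e x y).deg B = N.deg B - if (x ∈ B ↔ y ∈ B) then 0 else 1 := by
  have h1 : N.cut B = N.cross B e + (N.delete e x y).cut B :=
    (Finset.add_sum_erase N.edges (N.cross B) he).symm
  rw [← hj.cross_eq, deg, deg, h1]
  simp only [delete]
  ring

lemma bet_delete : (N.delete e x y).bet B =
    N.bet B - (if x ∈ B then 1 else 0) + (if y ∈ B then 1 else 0) := by
  simp only [bet, delete, Finset.sum_add_distrib, Finset.sum_sub_distrib, Finset.sum_ite_eq']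
  ring

lemma rootDeg_delete : (N.delete e x y).rootDeg = N.rootDeg := rfl

lemma rootBet_delete : (N.delete e x y).rootBet = N.rootBet := rfl

lemma size_delete (he : e ∈ N.edges) : (N.delete e x y).size = N.size - 1 := by
  have h1 : (N.delete e x y).edges.card + 1 = N.edges.card := Finset.card_erase_add_one he
  have h2 : (N.delete e x y).verts = N.verts := rfl
  unfold size
  rw [rootDeg_delete, h2]
  omega

lemma Frame.delete (h : N.Frame) (hx : x ∈ N.verts) (hy : y ∈ N.verts) :
    (N.delete e x y).Frame where
  closed e he := h.closed e (Finset.mem_of_mem_erase he)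
  p_nonneg := h.p_nonneg
  q_nonneg := h.q_nonneg
  sum_γ := by
    have := h.sum_γ
    simpa [RootedNet.delete, Finset.sum_add_distrib, Finset.sum_sub_distrib, hx, hy] using this

lemma Orientable.of_delete (he : e ∈ N.edges) (hj : N.Joins e x y)
    (h : (N.delete e x y).Orientable) : N.Orientable := by
  obtain ⟨σ, hσ, hf⟩ := h
  obtain ⟨c, hc, hnet⟩ := hj.exists_net_eq
  refine ⟨Function.update σ e c, fun f => ?_, fun v hv => ?_⟩
  · by_cases hfe : f = e
    · subst hfe
      simpa using hc
    · simpa [hfe] using hσ f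
  · have h1 := hf v hv
    have h2 : N.flow (Function.update σ e c) {v} =
        (if v = x then 1 else 0) - (if v = y then 1 else 0) + (N.delete e x y).flow σ {v} := by
      unfold flow
      rw [← Finset.add_sum_erase _ _ he]
      congr 1
      · have : c * c = 1 := by rcases hc with rfl | rfl <;> rfl
        rw [Function.update_self, hnet, ← mul_assoc, this, one_mul]
        simp only [Finset.mem_singleton, eq_comm]
      · refine Finset.sum_congr rfl fun f hf => ?_
        rw [Function.update_of_ne (Finset.ne_of_mem_erase hf)]
        rfl
    have h3 : (N.delete e x y).γ v =
      N.γ v - (if v = x then 1 else 0) + (if v = y then 1 else 0) := rfl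
    rw [h2]
    omega

end Delete

/-- Two edges that contribute `±1` suffice to adjust a signed sum modulo 3. -/
lemma exists_adjust {T : Finset E} {e₁ e₂ : E} (h₁ : e₁ ∈ T) (h₂ : e₂ ∈ T) (hne : e₁ ≠ e₂)
    {c : E → ℤ} (hc₁ : c e₁ = 1 ∨ c e₁ = -1) (hc₂ : c e₂ = 1 ∨ c e₂ = -1) {σ : E → ℤ}
    (hσ : ∀ e, σ e = 1 ∨ σ e = -1) (t : ℤ) : ∃ ρ : E → ℤ, (∀ e, ρ e = 1 ∨ ρ e = -1) ∧
      (∀ e, e ≠ e₁ → e ≠ e₂ → ρ e = σ e) ∧ 3 ∣ ∑ e ∈ T, ρ e * c e - t := by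
  have key : ∀ r : ℤ, ∃ s₁ s₂ : ℤ, (s₁ = 1 ∨ s₁ = -1) ∧ (s₂ = 1 ∨ s₂ = -1) ∧
      3 ∣ s₁ * c e₁ + (s₂ * c e₂ + r) - t := by
    intro r
    -- The sums ±1 ± 1 are 0, 2 and -2, one in each residue class.
    have h3 : (t - r) % 3 = 0 ∨ (t - r) % 3 = 1 ∨ (t - r) % 3 = 2 := by omega
    rcases h3 with h | h | h
    · refine ⟨c e₁, - c e₂, hc₁, by omega, ?_⟩
      rcases hc₁ with h1 | h1 <;> rcases hc₂ with h2 | h2 <;> rw [h1, h2] <;> omega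
    · refine ⟨- c e₁, - c e₂, by omega, by omega, ?_⟩
      rcases hc₁ with h1 | h1 <;> rcases hc₂ with h2 | h2 <;> rw [h1, h2] <;> omega
    · refine ⟨c e₁, c e₂, hc₁, hc₂, ?_⟩
      rcases hc₁ with h1 | h1 <;> rcases hc₂ with h2 | h2 <;> rw [h1, h2] <;> omega
  obtain ⟨s₁, s₂, hs₁, hs₂, h⟩ := key (∑ e ∈ (T.erase e₁).erase e₂, σ e * c e)
  refine ⟨fun e => if e = e₁ then s₁ else if e = e₂ then s₂ else σ e, fun e => ?_,
    fun e h1 h2 => by simp [h1, h2], ?_⟩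
  · dsimp only
    split_ifs
    exacts [hs₁, hs₂, hσ e]
  · have h₂' : e₂ ∈ T.erase e₁ := Finset.mem_erase.2 ⟨hne.symm, h₂⟩
    rw [← Finset.add_sum_erase _ _ h₁, ← Finset.add_sum_erase _ _ h₂']
    dsimp only
    rw [if_pos rfl, if_neg hne.symm, if_pos rfl]
    convert h using 5 with e he
    have h1 := Finset.ne_of_mem_erase he
    have h2 := Finset.ne_of_mem_erase (Finset.mem_of_mem_erase he)
    rw [if_neg h2, if_neg h1]

/-- After contraction of `x` and `y`, the two parallel edges are free to correct the outflow at `x`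
without affecting any third vertex; `y` is then correct because the total is zero. -/
lemma Critical.no_parallel (hN : N.Critical) {e₁ e₂ : E} (h₁ : e₁ ∈ N.edges) (h₂ : e₂ ∈ N.edges)
    (hne : e₁ ≠ e₂) (hxy : x ≠ y) (hx : x ∈ N.verts) (hj₁ : N.Joins e₁ x y)
    (hj₂ : N.Joins e₂ x y) : False := by
  obtain ⟨v₀, h⟩ := hN.valid
  have hy := h.mem_of_joins h₁ hj₁ hx
  obtain ⟨σ, hσ, hf⟩ := hN.exists_flow_contract (A := {x, y}) (a := x) (by simp)
    (by simp [Finset.insert_subset_iff, hx, hy]) (by rw [Finset.card_pair hxy]; omega)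
  obtain ⟨c₁, hc₁, hnet₁⟩ := hj₁.exists_net_eq
  obtain ⟨c₂, hc₂, hnet₂⟩ := hj₂.exists_net_eq
  obtain ⟨ρ, hρ, hρσ, hρt⟩ := exists_adjust (c := N.net {x}) h₁ h₂ hne
    (by simpa [hnet₁, hxy.symm] using hc₁) (by simpa [hnet₂, hxy.symm] using hc₂) hσ (N.γ x)
  refine hN.not_orientable (h.orientable hρ hy fun v hv hvy => ?_)
  by_cases hvx : v = x
  · subst hvx
    exact hρt
  · have : N.flow ρ {v} = N.flow σ {v} := by
      refine Finset.sum_congr rfl fun e _ => ?_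
      by_cases he₁ : e = e₁
      · subst he₁
        simp [hnet₁, Ne.symm hvx, Ne.symm hvy]
      by_cases he₂ : e = e₂
      · subst he₂
        simp [hnet₂, Ne.symm hvx, Ne.symm hvy]
      rw [hρσ e he₁ he₂]
    rw [this]
    exact hf v hv (by simp [hvx, hvy])

/-- The edges `e₁ = xv` and `e₂ = vy` are replaced by one edge `xy`. -/
def lift (N : RootedNet V E) (e₁ e₂ : E) (x y : V) : RootedNet V E :=
  { N with
    src := Function.update N.src e₁ x
    dst := Function.update N.dst e₁ y
    edges := N.edges.erase e₂ }

section Lift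

variable {e₁ e₂ : E} {v : V}

omit [DecidableEq V] in
lemma sum_lift (h₁ : e₁ ∈ N.edges) (h₂ : e₂ ∈ N.edges) (hne : e₁ ≠ e₂) (f g : E → ℤ)
    (hfg : ∀ e, e ≠ e₁ → e ≠ e₂ → g e = f e) :
    ∑ e ∈ N.edges, f e = ∑ e ∈ (N.lift e₁ e₂ x y).edges, g e + f e₁ + f e₂ - g e₁ := by
  have h₁' : e₁ ∈ N.edges.erase e₂ := Finset.mem_erase.2 ⟨hne, h₁⟩
  simp only [lift]
  rw [← Finset.add_sum_erase _ f h₂, ← Finset.add_sum_erase _ f h₁',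
    ← Finset.add_sum_erase _ g h₁']
  have : ∑ e ∈ (N.edges.erase e₂).erase e₁, g e = ∑ e ∈ (N.edges.erase e₂).erase e₁, f e :=
    Finset.sum_congr rfl fun e he => hfg e (Finset.ne_of_mem_erase he)
      (Finset.ne_of_mem_erase (Finset.mem_of_mem_erase he))
  rw [this]
  ring

omit [DecidableEq V] in
lemma lift_joins : (N.lift e₁ e₂ x y).Joins e₁ x y := by
  left
  simp [lift]

lemma cross_lift_of_ne (he : e ≠ e₁) : (N.lift e₁ e₂ x y).cross B e = N.cross B e := by
  simp [cross, lift, he]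

lemma net_lift_of_ne (he : e ≠ e₁) : (N.lift e₁ e₂ x y).net B e = N.net B e := by
  simp [net, lift, he]

lemma deg_lift (h₁ : e₁ ∈ N.edges) (h₂ : e₂ ∈ N.edges) (hne : e₁ ≠ e₂)
    (hj₁ : N.Joins e₁ v x) (hj₂ : N.Joins e₂ v y) :
    (N.lift e₁ e₂ x y).deg B = N.deg B - (if (v ∈ B ↔ x ∈ B) then 0 else 1) -
      (if (v ∈ B ↔ y ∈ B) then 0 else 1) + (if (x ∈ B ↔ y ∈ B) then 0 else 1) := by
  have h := sum_lift (x := x) (y := y) h₁ h₂ hne (N.cross B) ((N.lift e₁ e₂ x y).cross B)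
    fun e h1 _ => cross_lift_of_ne h1
  rw [hj₁.cross_eq, hj₂.cross_eq, lift_joins.cross_eq] at h
  unfold deg cut
  rw [h]
  simp only [lift]
  ring

omit [DecidableEq V] in
lemma bet_lift : (N.lift e₁ e₂ x y).bet B = N.bet B := rfl

omit [DecidableEq V] in
lemma size_lift (h₂ : e₂ ∈ N.edges) : (N.lift e₁ e₂ x y).size = N.size - 1 := by
  have h1 : (N.lift e₁ e₂ x y).edges.card + 1 = N.edges.card := Finset.card_erase_add_one h₂
  have h2 : (N.lift e₁ e₂ x y).verts = N.verts := rfl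
  have h3 : (N.lift e₁ e₂ x y).rootDeg = N.rootDeg := rfl
  unfold size
  rw [h2, h3]
  omega

omit [DecidableEq V] in
lemma Frame.lift (h : N.Frame) (hx : x ∈ N.verts) (hy : y ∈ N.verts) :
    (N.lift e₁ e₂ x y).Frame where
  closed e he := by
    by_cases he₁ : e = e₁
    · simp [RootedNet.lift, he₁, hx, hy]
    · simpa [RootedNet.lift, he₁] using h.closed e (Finset.mem_of_mem_erase he)
  p_nonneg := h.p_nonneg
  q_nonneg := h.q_nonneg
  sum_γ := h.sum_γ

/-- The direction of the new edge is given to the whole path from `x` through `v` to `y`, which adds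
nothing to the net outflow of `v`. -/
lemma Orientable.of_lift (h₁ : e₁ ∈ N.edges) (h₂ : e₂ ∈ N.edges) (hne : e₁ ≠ e₂)
    (hj₁ : N.Joins e₁ v x) (hj₂ : N.Joins e₂ v y) (h : (N.lift e₁ e₂ x y).Orientable) :
    N.Orientable := by
  obtain ⟨σ, hσ, hf⟩ := h
  obtain ⟨c₁, hc₁, hnet₁⟩ := hj₁.symm.exists_net_eq
  obtain ⟨c₂, hc₂, hnet₂⟩ := hj₂.exists_net_eq
  refine ⟨fun e => if e = e₁ then c₁ * σ e₁ else if e = e₂ then c₂ * σ e₁ else σ e,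
    fun e => ?_, fun u hu => ?_⟩
  · have := hσ e₁
    dsimp only
    split_ifs
    · rcases hc₁ with rfl | rfl <;> omega
    · rcases hc₂ with rfl | rfl <;> omega
    · exact hσ e
  · have h := hf u hu
    have h1 := sum_lift (x := x) (y := y) h₁ h₂ hne
      (fun e => (if e = e₁ then c₁ * σ e₁ else if e = e₂ then c₂ * σ e₁ else σ e) * N.net {u} e)
      (fun e => σ e * (N.lift e₁ e₂ x y).net {u} e)
      fun e h1 h2 => by simp only [net_lift_of_ne h1, if_neg h1, if_neg h2]
    have h2 : (N.lift e₁ e₂ x y).net {u} e₁ =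
        (if x ∈ ({u} : Finset V) then 1 else 0) - (if y ∈ ({u} : Finset V) then 1 else 0) := by
      simp [net, RootedNet.lift]
    rw [if_pos rfl, if_neg hne.symm, if_pos rfl, hnet₁, hnet₂, h2] at h1
    have h3 : c₁ * c₁ = 1 := by rcases hc₁ with rfl | rfl <;> rfl
    have h4 : c₂ * c₂ = 1 := by rcases hc₂ with rfl | rfl <;> rfl
    unfold flow at h ⊢
    rw [h1]
    convert h using 1
    simp only [RootedNet.lift]
    linear_combination (σ e₁ * ((if x ∈ ({u} : Finset V) then 1 else 0) -
      (if v ∈ ({u} : Finset V) then 1 else 0))) * h3 + (σ e₁ *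
      ((if v ∈ ({u} : Finset V) then 1 else 0) - (if y ∈ ({u} : Finset V) then 1 else 0))) * h4

end Lift

end RootedNet

/-! ### Structure of a minimal counterexample and the extension theorem -/

namespace RootedNet

variable {V E : Type*} [DecidableEq V] [DecidableEq E] {N : RootedNet V E} {v x y : V} {e : E}
  {A : Finset V}

omit [DecidableEq E] in
/-- Proper nonempty vertex sets are of three kinds. -/
lemma Critical.trichotomy (hN : N.Critical) (hA : A ⊆ N.verts) (hne : A.Nonempty)
    (hAS : A ≠ N.verts) (v : V) :
    A = {v} ∨ Big (N.deg A - 2) (N.bet A) ∨ ∃ w ∈ N.verts, w ≠ v ∧ A = {w} := by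
  rcases Nat.lt_or_ge 1 A.card with h | h
  · exact Or.inr <| Or.inl <| hN.big_of_one_lt_card (hA.ssubset_of_ne hAS) h
  · obtain ⟨w, rfl⟩ := Finset.card_eq_one.1 (le_antisymm h (Finset.card_pos.2 hne))
    by_cases hw : w = v
    · exact Or.inl (by rw [hw])
    · exact Or.inr <| Or.inr ⟨w, by simpa using hA, hw, rfl⟩

/-- Lifting at `v` an arc from the root together with an edge. -/
lemma Critical.not_lift_root (hN : N.Critical) (hv : v ∈ N.verts) (hd : N.deg {v} % 2 = 0)
    (hb : N.bet {v} % 3 = 0) (hbig : ∀ A ⊆ N.verts, A.Nonempty → A ≠ N.verts → A ≠ {v} →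
      Big (N.deg A) (N.bet A)) (he : e ∈ N.edges) (hj : N.Joins e v x) (hvx : v ≠ x)
    (hp : 1 ≤ N.p v) : False := by
  obtain ⟨v₀, h⟩ := hN.valid
  have hx := h.mem_of_joins he hj hv
  have hv' : v ∈ (N.addArcs x 1 0).verts := hv
  have he' : e ∈ ((N.addArcs x 1 0).addArcs v (-1) 0).edges := he
  have hj' : ((N.addArcs x 1 0).addArcs v (-1) 0).Joins e v x := hj
  -- Moving the root arc from `v` to `x` and deleting `e` directed from `v` to `x` lowers the degree
  -- of `v` by 2 and keeps its boundary. So τ = 0 persists, and `v` serves as the exceptional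
  -- vertex.
  refine hN.not_orientable <| .of_addArcs <| .of_addArcs <| .of_delete he' hj' <|
    hN.minimal _ v ?_ { toFrame := ?_, root := ?_, big := ?_ }
  · rw [size_delete he', size_addArcs hv', size_addArcs hx]
    omega
  · refine Frame.delete (Frame.addArcs (Frame.addArcs h.toFrame ?_ ?_) ?_ ?_) hv hx
    · have := h.p_nonneg x hx
      omega
    · have := h.q_nonneg x hx
      omega
    · simp only [addArcs, if_neg hvx]
      omega
    · have := h.q_nonneg v hv
      simp only [addArcs, if_neg hvx]
      omega
  · rw [rootDeg_delete, rootBet_delete, rootDeg_addArcs hv', rootBet_addArcs hv',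
      rootDeg_addArcs hx, rootBet_addArcs hx]
    convert h.root using 1 <;> ring
  · intro A hA hne hAS
    rw [deg_delete he' hj', bet_delete, deg_addArcs, bet_addArcs, deg_addArcs, bet_addArcs]
    by_cases hAv : A = {v}
    · subst hAv
      right
      simp only [Finset.mem_singleton, hvx.symm, if_true, if_false, iff_false, not_true]
      exact ⟨trivial, by omega, by omega⟩
    left
    have h1 := hbig A hA hne hAS hAv
    rcases hN.trichotomy hA hne hAS v with h2 | h2 | ⟨w, -, hwv, rfl⟩
    · exact absurd h2 hAv
    · unfold Big at *
      by_cases hvA : v ∈ A <;> by_cases hxA : x ∈ A <;> simp [hvA, hxA] <;> omega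
    · unfold Big at *
      by_cases hxw : x = w <;> simp [hwv.symm, hxw] <;> omega

/-- Lifting two edges at `v`. -/
lemma Critical.not_lift (hN : N.Critical) (hv : v ∈ N.verts) (hd : N.deg {v} % 2 = 0)
    (hb : N.bet {v} % 3 = 0) (hbig : ∀ A ⊆ N.verts, A.Nonempty → A ≠ N.verts → A ≠ {v} →
      Big (N.deg A) (N.bet A)) {e₁ e₂ : E} (h₁ : e₁ ∈ N.edges) (h₂ : e₂ ∈ N.edges)
    (hne : e₁ ≠ e₂) (hj₁ : N.Joins e₁ v x) (hj₂ : N.Joins e₂ v y) (hvx : v ≠ x) (hvy : v ≠ y) :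
    False := by
  obtain ⟨v₀, h⟩ := hN.valid
  have hx := h.mem_of_joins h₁ hj₁ hv
  have hy := h.mem_of_joins h₂ hj₂ hv
  have hxy : x ≠ y := by
    rintro rfl
    exact hN.no_parallel h₁ h₂ hne hvx hv hj₁ hj₂
  refine hN.not_orientable <| .of_lift h₁ h₂ hne hj₁ hj₂ <|
    hN.minimal _ v ?_ { toFrame := h.toFrame.lift hx hy, root := h.root, big := ?_ }
  · rw [size_lift h₂]
    omega
  · intro A hA hne' hAS
    rw [deg_lift h₁ h₂ hne hj₁ hj₂, bet_lift]
    by_cases hAv : A = {v}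
    · subst hAv
      right
      simp only [Finset.mem_singleton, hvx.symm, hvy.symm, if_true, if_false, iff_false, not_true]
      exact ⟨trivial, by omega, by omega⟩
    left
    have h1 := hbig A hA hne' hAS hAv
    -- A nontrivial set loses at most 2, which its slack covers; a single vertex other than `v`
    -- loses nothing because `x ≠ y`.
    rcases hN.trichotomy hA hne' hAS v with h2 | h2 | ⟨w, -, hwv, rfl⟩
    · exact absurd h2 hAv
    · unfold Big at *
      by_cases hvA : v ∈ A <;> by_cases hxA : x ∈ A <;> by_cases hyA : y ∈ A <;>
        simp [hvA, hxA, hyA] <;> omega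
    · unfold Big at *
      by_cases hxw : x = w
      · subst hxw
        simp [hwv.symm, hxy.symm]
        omega
      · by_cases hyw : y = w <;> simp [hwv.symm, hxw, hyw] <;> omega

omit [DecidableEq E] in
/-- Without edges at `v` other than arcs at the root, a vertex `v` with `τ = 0` is isolated and can
be deleted. -/
lemma Critical.cut_singleton_ne_zero (hN : N.Critical) (hv : v ∈ N.verts)
    (hd : N.deg {v} % 2 = 0) (hb : N.bet {v} % 3 = 0) (hbig : ∀ A ⊆ N.verts, A.Nonempty → A ≠ N.verts → A ≠ {v} →
      Big (N.deg A) (N.bet A)) : N.cut {v} ≠ 0 := by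
  intro hcut
  obtain ⟨v₀, h⟩ := hN.valid
  have hcross : ∀ e ∈ N.edges, (N.src e = v ↔ N.dst e = v) := by
    intro e he
    have := (Finset.sum_eq_zero_iff_of_nonneg fun e _ => N.cross_nonneg {v} e).1 hcut e he
    simpa [cross] using this
  have hclosed : ∀ e ∈ N.edges, (N.src e ∈ N.verts.erase v ↔ N.dst e ∈ N.verts.erase v) := by
    intro e he
    have h1 := hcross e he
    have h2 := h.closed e he
    simp only [Finset.mem_erase]
    tauto
  have hcutA : N.cut (N.verts.erase v) = 0 :=
    Finset.sum_eq_zero fun e he => if_pos (hclosed e he)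
  have hdeg : N.deg (N.verts.erase v) + (N.p v + N.q v) = N.rootDeg := by
    rw [deg, hcutA, zero_add, rootDeg, Finset.sum_erase_add _ _ hv]
  have hbet : N.bet (N.verts.erase v) + N.bet {v} = ∑ w ∈ N.verts, N.γ w - N.rootBet := by
    rw [bet, bet, Finset.sum_singleton, Finset.sum_erase_add _ _ hv, rootBet,
      ← Finset.sum_sub_distrib]
    exact Finset.sum_congr rfl fun w _ => by ring
  have hne : (N.verts.erase v).Nonempty := by
    rw [← Finset.card_pos, Finset.card_erase_of_mem hv]
    have := hN.one_lt_card
    omega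
  have h1 := hbig _ (Finset.erase_subset _ _) hne (Finset.erase_ssubset hv).ne
    (fun hh => Finset.notMem_erase v N.verts (hh ▸ Finset.mem_singleton_self v))
  have h2 := h.root
  have h3 := h.sum_γ
  have hp := h.p_nonneg v hv
  have hq := h.q_nonneg v hv
  have hd' : N.deg {v} = N.p v + N.q v := by rw [deg, hcut, zero_add, Finset.sum_singleton]
  have hb' : N.bet {v} = N.γ v - N.p v + N.q v := Finset.sum_singleton _ _
  -- The remaining vertices have degree `rootDeg` minus the even degree of `v`, and the same |τ| as
  -- the root. The lower bound for them and the upper bound for the root force degree 0 at `v`.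
  have h4 : N.p v = 0 ∧ N.q v = 0 := by
    unfold Big at h1
    unfold Small at h2
    omega
  have hrd : ∑ w ∈ N.verts.erase v, (N.p w + N.q w) = N.rootDeg := by
    rw [rootDeg, ← Finset.add_sum_erase _ _ hv]
    omega
  have hrb : ∑ w ∈ N.verts.erase v, (N.p w - N.q w) = N.rootBet := by
    rw [rootBet, ← Finset.add_sum_erase _ _ hv]
    omega
  obtain ⟨σ, hσ, hf⟩ := hN.minimal { N with verts := N.verts.erase v } v₀
    (by
      have := Finset.card_erase_lt_of_mem hv
      simp only [size, rootDeg] at *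
      omega)
    { closed := hclosed
      p_nonneg := fun w hw => h.p_nonneg w (Finset.mem_of_mem_erase hw)
      q_nonneg := fun w hw => h.q_nonneg w (Finset.mem_of_mem_erase hw)
      sum_γ := by
        have := Finset.add_sum_erase _ N.γ hv
        dsimp only
        omega
      root := by
        simp only [rootDeg, rootBet] at *
        rwa [hrd, hrb]
      big := fun A hA hne hAS => by
        have hAv : v ∉ A := fun hh => Finset.notMem_erase v N.verts (hA hh)
        exact Or.inl <| hbig A (hA.trans (Finset.erase_subset _ _)) hne
          (fun hh => hAv (hh ▸ hv)) fun hh => hAv (hh ▸ Finset.mem_singleton_self v) }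
  exact hN.not_orientable <| h.orientable hσ hv fun w hw hwv =>
    hf w (Finset.mem_erase.2 ⟨hwv, hw⟩)

/-- Every case lifts at `v`, whose own degree bound is waived in the smaller net: two edges if there
are two, otherwise an edge with a root arc. -/
lemma Critical.not_zero_of_big (hN : N.Critical) (hv : v ∈ N.verts) (hd : N.deg {v} % 2 = 0)
    (hb : N.bet {v} % 3 = 0) (hbig : ∀ A ⊆ N.verts, A.Nonempty → A ≠ N.verts → A ≠ {v} →
      Big (N.deg A) (N.bet A)) : False := by
  have hcut := hN.cut_singleton_ne_zero hv hd hb hbig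
  obtain ⟨v₀, h⟩ := hN.valid
  obtain ⟨e₁, h₁, hc₁⟩ := Finset.exists_ne_zero_of_sum_ne_zero hcut
  obtain ⟨v', hv', x, hx, hj₁⟩ := exists_joins_of_cross_ne_zero hc₁
  rw [Finset.mem_singleton] at hv' hx
  subst hv'
  by_cases hex : ∃ e₂ ∈ N.edges, e₁ ≠ e₂ ∧ N.cross {v'} e₂ ≠ 0
  · obtain ⟨e₂, h₂, hne, hc₂⟩ := hex
    obtain ⟨v, hv'', y, hy, hj₂⟩ := exists_joins_of_cross_ne_zero hc₂
    rw [Finset.mem_singleton] at hv'' hy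
    subst hv''
    exact hN.not_lift hv hd hb hbig h₁ h₂ hne hj₁ hj₂ (Ne.symm hx) (Ne.symm hy)
  · push Not at hex
    have hcut1 : N.cut {v'} = 1 := by
      unfold cut
      rw [Finset.sum_eq_single_of_mem e₁ h₁ fun e he hne => hex e he hne.symm, hj₁.cross_eq]
      simp [hx]
    have hdeg : N.deg {v'} = 1 + (N.p v' + N.q v') := by
      rw [deg, hcut1, Finset.sum_singleton]
    have hp := h.p_nonneg v' hv
    have hq := h.q_nonneg v' hv
    -- The degree is even and only one edge avoids the root, so a root arc exists; if none enters
    -- `v'`, reversal turns a leaving arc into an entering one.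
    rcases lt_or_ge 0 (N.p v') with hp' | hp'
    · exact hN.not_lift_root hv hd hb hbig h₁ hj₁ (Ne.symm hx) hp'
    · refine hN.reverse.not_lift_root (v := v') hv (by rwa [deg_reverse])
        (by rw [bet_reverse]; omega) (fun A hA hne hAS hAv => ?_) h₁ hj₁ (Ne.symm hx) ?_
      · have := hbig A hA hne hAS hAv
        rw [deg_reverse, bet_reverse]
        unfold Big at *
        omega
      · change 1 ≤ N.q v'
        omega

/-- The exceptional vertex is itself excluded by the lifting argument, so the exception never
occurs. -/
lemma Critical.big (hN : N.Critical) (hA : A ⊆ N.verts) (hne : A.Nonempty) (hAS : A ≠ N.verts) :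
    Big (N.deg A) (N.bet A) := by
  obtain ⟨v₀, h⟩ := hN.valid
  refine (h.big A hA hne hAS).resolve_right ?_
  rintro ⟨rfl, hd, hb⟩
  exact hN.not_zero_of_big (hA (Finset.mem_singleton_self _)) hd hb
    fun A hA hne hAS hAv => (h.big A hA hne hAS).resolve_right fun hh => hAv hh.1

/-- No vertex of a minimal counterexample has `τ = 0`. -/
lemma Critical.not_zero (hN : N.Critical) (hv : v ∈ N.verts) :
    ¬ (N.deg {v} % 2 = 0 ∧ N.bet {v} % 3 = 0) := fun h =>
  hN.not_zero_of_big hv h.1 h.2 fun _ hA hne hAS _ => hN.big hA hne hAS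

omit [DecidableEq E] in
lemma Critical.singleton_ne_verts (hN : N.Critical) (v : V) : ({v} : Finset V) ≠ N.verts := by
  intro h
  have := hN.one_lt_card
  simp [← h] at this

/-- Without crossing edges the degrees of `A` and its complement, each at least 4, would add up to
the root degree, which is at most 7. -/
lemma Critical.exists_crossing (hN : N.Critical) (hA : A ⊆ N.verts) (hne : A.Nonempty)
    (hAS : A ≠ N.verts) : ∃ e ∈ N.edges, ∃ x ∈ A, ∃ y ∈ N.verts, y ∉ A ∧ N.Joins e x y := by
  obtain ⟨v₀, h⟩ := hN.valid
  have hcut : N.cut A ≠ 0 := by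
    intro hcut
    have hcross := (Finset.sum_eq_zero_iff_of_nonneg fun e _ => N.cross_nonneg A e).1 hcut
    have hcut' : N.cut (N.verts \ A) = 0 := by
      refine Finset.sum_eq_zero fun e he => if_pos ?_
      have h1 := h.closed e he
      have h2 := hcross e he
      simp only [cross, ite_eq_left_iff, one_ne_zero, imp_false, not_not] at h2
      simp only [Finset.mem_sdiff]
      tauto
    have h1 := hN.big hA hne hAS
    have h2 := hN.big (A := N.verts \ A) Finset.sdiff_subset
      (Finset.sdiff_nonempty.2 fun hh => hAS (hA.antisymm hh))
      fun hh => by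
        obtain ⟨a, ha⟩ := hne
        exact (Finset.mem_sdiff.1 (hh ▸ hA ha)).2 ha
    have h3 : N.deg (N.verts \ A) + N.deg A = N.rootDeg := by
      rw [deg, deg, hcut, hcut', zero_add, zero_add, Finset.sum_sdiff hA, rootDeg]
    have h4 := h.root
    unfold Big at h1 h2
    unfold Small at h4
    omega
  obtain ⟨e, he, hc⟩ := Finset.exists_ne_zero_of_sum_ne_zero hcut
  obtain ⟨x, hx, y, hy, hj⟩ := exists_joins_of_cross_ne_zero hc
  exact ⟨e, he, x, hx, y, h.mem_of_joins he hj (hA hx), hy, hj⟩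

/-- An edge of a minimal counterexample cannot be oriented from `x` to `y` and deleted without
violating the degree condition at `x` or `y`. -/
lemma Critical.not_delete (hN : N.Critical) (he : e ∈ N.edges) (hj : N.Joins e x y) (hxy : x ≠ y)
    (hx : x ∈ N.verts) (hbx : Big (N.deg {x} - 1) (N.bet {x} - 1))
    (hby : Big (N.deg {y} - 1) (N.bet {y} + 1)) : False := by
  obtain ⟨v₀, h⟩ := hN.valid
  have hy := h.mem_of_joins he hj hx
  refine hN.not_orientable <| .of_delete he hj <|
    hN.minimal _ x ?_ { toFrame := h.toFrame.delete hx hy, root := h.root, big := ?_ }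
  · rw [size_delete he]
    omega
  · intro A hA hne hAS
    left
    rw [deg_delete he hj, bet_delete]
    rcases hN.trichotomy hA hne hAS x with rfl | h2 | ⟨w, -, hwx, rfl⟩
    · simpa [hxy.symm] using hbx
    -- The degree drops by at most 1 and |τ| grows by at most 1, within the slack of 2.
    · unfold Big at *
      by_cases hxA : x ∈ A <;> by_cases hyA : y ∈ A <;> simp [hxA, hyA] <;> omega
    · by_cases hyw : y = w
      · subst hyw
        simpa [hxy] using hby
      · simpa [hyw, hwx.symm] using hN.big hA hne hAS

/-- The residue `τ` determined by `d` and `b` is `1`, `2` or `3`. -/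
def Pos (d b : ℤ) : Prop := (d % 2 = 1 ∧ b % 3 ≠ 2) ∨ (d % 2 = 0 ∧ b % 3 = 2)

/-- The residue `τ` determined by `d` and `b` is `-1`, `-2` or `3`. -/
def Neg (d b : ℤ) : Prop := (d % 2 = 1 ∧ b % 3 ≠ 1) ∨ (d % 2 = 0 ∧ b % 3 = 1)

/-- Directing the edge from the positive to the negative end and deleting it lowers both degree and
|τ| by 1 at each end. -/
lemma Critical.not_pos_neg (hN : N.Critical) (he : e ∈ N.edges) (hj : N.Joins e x y) (hxy : x ≠ y)
    (hx : x ∈ N.verts) (hpx : Pos (N.deg {x}) (N.bet {x})) (hny : Neg (N.deg {y}) (N.bet {y})) :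
    False := by
  obtain ⟨v₀, h⟩ := hN.valid
  have hy := h.mem_of_joins he hj hx
  have h1 := hN.big (by simpa) (Finset.singleton_nonempty x) (hN.singleton_ne_verts x)
  have h2 := hN.big (by simpa) (Finset.singleton_nonempty y) (hN.singleton_ne_verts y)
  refine hN.not_delete he hj hxy hx ?_ ?_
  · unfold Big Pos at *
    omega
  · unfold Big Neg at *
    omega

/-- Since τ ≠ 0, every vertex has a sign (both if τ = 3), and by connectedness a mixture of signs
would appear along some edge. -/
lemma Critical.forall_not_neg_or_forall_not_pos (hN : N.Critical) :
    (∀ v ∈ N.verts, ¬ Neg (N.deg {v}) (N.bet {v})) ∨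
      (∀ v ∈ N.verts, ¬ Pos (N.deg {v}) (N.bet {v})) := by
  classical
  have hpn : ∀ v ∈ N.verts, Pos (N.deg {v}) (N.bet {v}) ∨ Neg (N.deg {v}) (N.bet {v}) := by
    intro v hv
    have := hN.not_zero hv
    unfold Pos Neg
    omega
  by_contra! hcon
  obtain ⟨⟨v, hv, hnv⟩, ⟨u, hu, hpu⟩⟩ := hcon
  set A := N.verts.filter fun w => Pos (N.deg {w}) (N.bet {w}) with hAdef
  have hA : A ⊆ N.verts := Finset.filter_subset _ _
  have hne : A.Nonempty := ⟨u, Finset.mem_filter.2 ⟨hu, hpu⟩⟩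
  by_cases hAS : A = N.verts
  · obtain ⟨e, he, x, hx, y, hy, hyx, hj⟩ := hN.exists_crossing (A := {v}) (by simpa)
      (Finset.singleton_nonempty v) (hN.singleton_ne_verts v)
    rw [Finset.mem_singleton] at hx hyx
    subst hx
    exact hN.not_pos_neg he hj.symm hyx hy (Finset.mem_filter.1 (hAS ▸ hy : y ∈ A)).2 hnv
  · obtain ⟨e, he, x, hx, y, hy, hyx, hj⟩ := hN.exists_crossing hA hne hAS
    have hpy : ¬ Pos (N.deg {y}) (N.bet {y}) := fun hh => hyx (Finset.mem_filter.2 ⟨hy, hh⟩)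
    exact hN.not_pos_neg he hj (by rintro rfl; exact hyx hx) (hA hx) (Finset.mem_filter.1 hx).2
      ((hpn y hy).resolve_left hpy)

/-- The root of a minimal counterexample is not isolated. -/
lemma Critical.rootDeg_ne_zero (hN : N.Critical) : N.rootDeg ≠ 0 := by
  intro h0
  obtain ⟨v₀, h⟩ := hN.valid
  have hpq : ∀ v ∈ N.verts, N.p v = 0 ∧ N.q v = 0 := by
    intro v hv
    have h1 := (Finset.sum_eq_zero_iff_of_nonneg fun v hv =>
      add_nonneg (h.p_nonneg v hv) (h.q_nonneg v hv)).1 h0 v hv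
    have h2 := h.p_nonneg v hv
    have h3 := h.q_nonneg v hv
    omega
  -- A vertex with d ≤ 4 + |τ| could take over the role of the root: two of its edges adjust its
  -- outflow, and the orientation extends to the rest. Hence single vertices have slack too, and any
  -- edge may be deleted.
  have hlarge : ∀ x ∈ N.verts, Big (N.deg {x} - 2) (N.bet {x}) := by
    intro x hx
    by_contra hnb
    have hb := hN.big (by simpa) (Finset.singleton_nonempty x) (hN.singleton_ne_verts x)
    have hdx : N.deg {x} = N.cut {x} := by
      rw [deg, Finset.sum_singleton, (hpq x hx).1, (hpq x hx).2]
      simp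
    have hcard : 1 < (N.edges.filter fun e => N.cross {x} e ≠ 0).card := by
      have h1 : N.cut {x} ≤ (N.edges.filter fun e => N.cross {x} e ≠ 0).card := by
        rw [cut, ← Finset.sum_filter_ne_zero, Finset.cast_card]
        refine Finset.sum_le_sum fun e _ => ?_
        unfold cross
        split_ifs <;> simp
      unfold Big at hb
      omega
    obtain ⟨e₁, h₁, e₂, h₂, hne⟩ := Finset.one_lt_card.1 hcard
    rw [Finset.mem_filter] at h₁ h₂
    have hnet : ∀ e, N.cross {x} e ≠ 0 → N.net {x} e = 1 ∨ N.net {x} e = -1 := by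
      intro e he
      obtain ⟨x', hx', y, hy, hj⟩ := exists_joins_of_cross_ne_zero he
      obtain ⟨c, hc, hcn⟩ := hj.exists_net_eq
      rw [hcn, if_pos hx', if_neg hy]
      omega
    obtain ⟨σ, hσ, -, hf⟩ := exists_adjust h₁.1 h₂.1 hne (hnet _ h₁.2) (hnet _ h₂.2)
      (σ := fun _ => 1) (fun _ => Or.inl rfl) (N.γ x)
    refine hN.not_small (Finset.erase_ssubset hx) hσ (fun v hv hvx => ?_) ?_
    · have : v = x := by
        by_contra hh
        exact hvx (Finset.mem_erase.2 ⟨hh, hv⟩)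
      subst this
      exact hf
    · have hd : N.deg (N.verts.erase x) = N.deg {x} := by
        rw [hdx, deg]
        have h1 : ∑ v ∈ N.verts.erase x, (N.p v + N.q v) = 0 :=
          Finset.sum_eq_zero fun v hv => by
            have := hpq v (Finset.mem_of_mem_erase hv)
            omega
        rw [h1, add_zero]
        refine Finset.sum_congr rfl fun e he => ?_
        have := h.closed e he
        unfold cross
        congr 1
        simp only [Finset.mem_erase, Finset.mem_singleton, eq_iff_iff]
        by_cases h1 : N.src e = x <;> by_cases h2 : N.dst e = x <;> simp_all
      have hb' : N.bet (N.verts.erase x) + N.bet {x} = ∑ v ∈ N.verts, N.γ v := by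
        rw [bet, bet, Finset.sum_singleton, Finset.sum_erase_add _ _ hx]
        refine Finset.sum_congr rfl fun v hv => ?_
        have := hpq v hv
        omega
      have h3 := h.sum_γ
      rw [hd]
      unfold Big at *
      unfold Small
      omega
  have hcard := hN.one_lt_card
  obtain ⟨u, hu⟩ := Finset.card_pos.1 (by omega : 0 < N.verts.card)
  obtain ⟨e, he, x, hx, y, hy, hyx, hj⟩ := hN.exists_crossing (A := {u}) (by simpa)
    (Finset.singleton_nonempty u) (hN.singleton_ne_verts u)
  rw [Finset.mem_singleton] at hx hyx
  subst hx
  have hbx := hlarge x hu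
  have hby := hlarge y hy
  refine hN.not_delete he hj (Ne.symm hyx) hu ?_ ?_
  · unfold Big at *
    omega
  · unfold Big at *
    omega

/-- Here every τ is 1 or 2, and the contradiction comes from a second minimal counterexample of
equal size in which both signs occur. -/
lemma Critical.false_of_not_neg (hN : N.Critical)
    (hpos : ∀ v ∈ N.verts, ¬ Neg (N.deg {v}) (N.bet {v})) : False := by
  obtain ⟨v₀, h⟩ := hN.valid
  have hroot := h.root
  have hsingle : ∀ v ∈ N.verts, Big (N.deg {v}) (N.bet {v}) ∧
      ((N.deg {v} % 2 = 1 ∧ N.bet {v} % 3 = 1) ∨ (N.deg {v} % 2 = 0 ∧ N.bet {v} % 3 = 2)) := by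
    intro v hv
    have h1 := hN.not_zero hv
    have h2 := hpos v hv
    unfold Neg at h2
    exact ⟨hN.big (by simpa) (Finset.singleton_nonempty v) (hN.singleton_ne_verts v), by omega⟩
  -- Removing an arc from `v` to the root lowers degree and τ at `v` by 1, and |τ| at the root by at
  -- most 1.
  have hq : ∀ v ∈ N.verts, N.q v = 0 := by
    intro v hv
    by_contra hq
    have hq' := h.q_nonneg v hv
    refine hN.not_orientable <| .of_addArcs <|
      hN.minimal (N.addArcs v 0 (-1)) v ?_ { toFrame := ?_, root := ?_, big := ?_ }
    · rw [size_addArcs hv]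
      omega
    · refine h.toFrame.addArcs ?_ (by omega)
      simpa using h.p_nonneg v hv
    · rw [rootDeg_addArcs hv, rootBet_addArcs hv]
      unfold Small at *
      omega
    · intro A hA hne hAS
      left
      rw [deg_addArcs, bet_addArcs]
      rcases hN.trichotomy hA hne hAS v with rfl | h2 | ⟨w, -, hwv, rfl⟩
      · have := hsingle v hv
        simp only [Finset.mem_singleton, if_true]
        unfold Big at *
        omega
      · unfold Big at *
        split_ifs <;> omega
      · simpa [hwv.symm] using hN.big hA hne hAS
  have hdb : N.rootDeg = N.rootBet := by
    refine Finset.sum_congr rfl fun v hv => ?_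
    rw [hq v hv]
    ring
  obtain ⟨v, hv, hpv⟩ : ∃ v ∈ N.verts, 1 ≤ N.p v := by
    by_contra! hcon
    refine hN.rootDeg_ne_zero (Finset.sum_eq_zero fun v hv => ?_)
    have := hcon v hv
    have := h.p_nonneg v hv
    have := hq v hv
    omega
  obtain ⟨e, he, v', hv', x, hx, hxv, hj⟩ := hN.exists_crossing (A := {v}) (by simpa)
    (Finset.singleton_nonempty v) (hN.singleton_ne_verts v)
  rw [Finset.mem_singleton] at hv' hxv
  subst hv'
  -- One arc from the root to `v'` is replaced by two arcs from `v'` to the root, and the edge `e`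
  -- is oriented from `x` to `v'` and deleted.
  have he' : e ∈ (N.addArcs v' (-1) 2).edges := he
  have hj' : (N.addArcs v' (-1) 2).Joins e x v' := hj.symm
  have hM : ((N.addArcs v' (-1) 2).delete e x v').Critical := by
    refine ⟨⟨v', { toFrame := ?_, root := ?_, big := ?_ }⟩,
      fun hh => hN.not_orientable (.of_addArcs (.of_delete he' hj' hh)), fun M w hs hM => ?_⟩
    · refine Frame.delete (h.toFrame.addArcs (by omega) ?_) hx hv
      have := h.q_nonneg v' hv
      omega
    -- When degree and outflow of the root coincide, the values 6 and 7 violate `Small`. So the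
    -- degree is at most 5 before the exchange, and at most 6 after it; in the case 6 the new
    -- outflow is 2, not divisible by 3.
    · rw [rootDeg_delete, rootBet_delete, rootDeg_addArcs hv, rootBet_addArcs hv, ← hdb]
      rw [← hdb] at hroot
      unfold Small at *
      omega
    · intro A hA hne hAS
      left
      rw [deg_delete he' hj', bet_delete, deg_addArcs, bet_addArcs]
      rcases hN.trichotomy hA hne hAS v' with rfl | h2 | ⟨w, -, hwv, rfl⟩
      · have := hsingle v' hv
        simp only [Finset.mem_singleton, hxv, if_true, if_false, iff_true]
        unfold Big at *
        omega
      · unfold Big at *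
        by_cases hvA : v' ∈ A <;> by_cases hxA : x ∈ A <;> simp [hvA, hxA] <;> omega
      · by_cases hxw : x = w
        · subst hxw
          have := hsingle x hx
          simp only [Finset.mem_singleton, hwv.symm, if_true, if_false, iff_false, not_true]
          unfold Big at *
          omega
        · simpa [hxw, hwv.symm] using hN.big hA hne hAS
    -- One more root arc and one edge less: the size is unchanged, so minimality is inherited.
    · refine hN.minimal M w ?_ hM
      rw [size_delete he', size_addArcs hv] at hs
      omega
  have hdv : ((N.addArcs v' (-1) 2).delete e x v').deg {v'} = N.deg {v'} := by
    rw [deg_delete he' hj', deg_addArcs]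
    simp [hxv]
  have hbv : ((N.addArcs v' (-1) 2).delete e x v').bet {v'} = N.bet {v'} + 4 := by
    rw [bet_delete, bet_addArcs]
    simp [hxv]
    ring
  have hdx : ((N.addArcs v' (-1) 2).delete e x v').deg {x} = N.deg {x} - 1 := by
    rw [deg_delete he' hj', deg_addArcs]
    simp [Ne.symm hxv]
  have hbx : ((N.addArcs v' (-1) 2).delete e x v').bet {x} = N.bet {x} - 1 := by
    rw [bet_delete, bet_addArcs]
    simp [Ne.symm hxv]
  have h1 := hsingle v' hv
  have h2 := hsingle x hx
  have h3 := hM.not_zero (v := v') hv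
  have h4 := hM.not_zero (v := x) hx
  rw [hdv, hbv] at h3
  rw [hdx, hbx] at h4
  -- As τ = 0 is excluded, τ went from 1 to -1 at `v'` and from 2 to 1 at `x`.
  rcases hM.forall_not_neg_or_forall_not_pos with hc | hc
  · have := hc v' hv
    rw [hdv, hbv] at this
    unfold Neg at this
    omega
  · have := hc x hx
    rw [hdx, hbx] at this
    unfold Pos at this
    omega

/-- The partial flow extension theorem of Lovász, Thomassen, Wu and Zhang. -/
theorem Valid.exists_orientation {v₀ : V} (h : N.Valid v₀) : N.Orientable := by
  have key : ∀ n : ℕ, ∀ (N : RootedNet V E) (v₀ : V), N.size < n → N.Valid v₀ → N.Orientable := by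
    intro n
    induction n with
    | zero =>
      intro N v₀ hn h
      have := h.size_nonneg
      push_cast at hn
      omega
    | succ n ih =>
      intro N v₀ hn h
      by_contra hno
      have hN : N.Critical := ⟨⟨v₀, h⟩, hno, fun M w hM => ih M w (by push_cast at hn; omega)⟩
      rcases hN.forall_not_neg_or_forall_not_pos with hc | hc
      · exact hN.false_of_not_neg hc
      · refine hN.reverse.false_of_not_neg fun v hv => ?_
        have := hc v hv
        rw [deg_reverse, bet_reverse]
        unfold Pos at this
        unfold Neg
        omega
  have h0 := h.size_nonneg
  exact key (N.size.toNat + 1) N v₀ (by push_cast; omega) h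

end RootedNet

/-! ### Transversals of the minimum cuts -/

namespace RootedNet

variable {V E : Type*} [DecidableEq V] {N : RootedNet V E}

lemma cut_posimodular (N : RootedNet V E) (A B : Finset V) :
    N.cut (A \ B) + N.cut (B \ A) ≤ N.cut A + N.cut B := by
  unfold cut
  rw [← Finset.sum_add_distrib, ← Finset.sum_add_distrib]
  refine Finset.sum_le_sum fun e _ => ?_
  simp only [cross, Finset.mem_sdiff]
  by_cases h1 : N.src e ∈ A <;> by_cases h2 : N.src e ∈ B <;>
    by_cases h3 : N.dst e ∈ A <;> by_cases h4 : N.dst e ∈ B <;> simp [h1, h2, h3, h4]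

variable [Fintype V]

/-- `A` is a proper nonempty vertex set whose boundary has the least possible size `k`. -/
def IsMinCut (N : RootedNet V E) (k : ℤ) (A : Finset V) : Prop :=
  A.Nonempty ∧ A ≠ Finset.univ ∧ N.cut A = k

/-- Posimodularity makes `A \ B` a side of a minimum cut as well, so minimality of `A` gives `A \ B
= A`. -/
lemma disjoint_of_minimal {k : ℤ}
    (hk : ∀ A : Finset V, A.Nonempty → A ≠ Finset.univ → k ≤ N.cut A) {A B : Finset V}
    (hA : Minimal (N.IsMinCut k) A) (hB : Minimal (N.IsMinCut k) B) (hne : A ≠ B) :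
    Disjoint A B := by
  have hAB : ¬ A ⊆ B := fun h => hne (h.antisymm (hB.2 hA.1 h))
  have hBA : ¬ B ⊆ A := fun h => hne ((hA.2 hB.1 h).antisymm h)
  have h1 : (A \ B).Nonempty := Finset.sdiff_nonempty.2 hAB
  have h2 : (B \ A).Nonempty := Finset.sdiff_nonempty.2 hBA
  have h3 : A \ B ≠ Finset.univ := by
    obtain ⟨b, hb⟩ := hB.1.1
    intro h
    exact (Finset.mem_sdiff.1 (h ▸ Finset.mem_univ b)).2 hb
  have h4 : B \ A ≠ Finset.univ := by
    obtain ⟨a, ha⟩ := hA.1.1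
    intro h
    exact (Finset.mem_sdiff.1 (h ▸ Finset.mem_univ a)).2 ha
  have h5 := hk _ h1 h3
  have h6 := hk _ h2 h4
  have h7 := N.cut_posimodular A B
  have h8 := hA.1.2.2
  have h9 := hB.1.2.2
  have h10 := hA.2 (y := A \ B) ⟨h1, h3, by omega⟩ Finset.sdiff_subset
  rw [Finset.disjoint_left]
  exact fun x hx => (Finset.mem_sdiff.1 (h10 hx)).2

/-- If the cuts of minimum size number at most `n ≥ 2`, then their sides have a transversal of
at most `n` vertices. -/
lemma exists_transversal {k : ℤ} (hkpos : 0 < k)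
    (hk : ∀ A : Finset V, A.Nonempty → A ≠ Finset.univ → k ≤ N.cut A) {n : ℕ} (hn : 2 ≤ n)
    {𝒞 : Type*} (C : Finset V → 𝒞) (hC : ∀ A B, C A = C B → ∀ e, N.cross A e = N.cross B e)
    (hCn : ∀ F : Finset (Finset V), (∀ A ∈ F, N.IsMinCut k A) → Set.InjOn C F → F.card ≤ n) :
    ∃ X : Finset V, X.card ≤ n ∧ ∀ A, N.IsMinCut k A → (A ∩ X).Nonempty := by
  classical
  -- If two sides give the same cut, no edge crosses their symmetric difference, which is therefore
  -- empty or everything.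
  have hcompl : ∀ A B : Finset V, C A = C B → A = B ∨ A = Bᶜ := by
    intro A B hAB
    have hcut : N.cut (symmDiff A B) = 0 := by
      refine Finset.sum_eq_zero fun e _ => ?_
      have := hC A B hAB e
      simp only [cross, Finset.mem_symmDiff] at this ⊢
      by_cases h1 : N.src e ∈ A <;> by_cases h2 : N.src e ∈ B <;>
        by_cases h3 : N.dst e ∈ A <;> by_cases h4 : N.dst e ∈ B <;> simp_all
    rcases (symmDiff A B).eq_empty_or_nonempty with h | h
    · exact Or.inl (symmDiff_eq_bot.1 h)
    · right
      have huniv : symmDiff A B = Finset.univ := by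
        by_contra hne
        have := hk _ h hne
        omega
      ext x
      have := huniv ▸ Finset.mem_univ x
      rw [Finset.mem_symmDiff] at this
      rw [Finset.mem_compl]
      tauto
  let F : Finset (Finset V) := Finset.univ.filter fun A => Minimal (N.IsMinCut k) A
  have hF : ∀ A, A ∈ F ↔ Minimal (N.IsMinCut k) A := fun A => by simp [F]
  have hcard : F.card ≤ n := by
    by_cases hinj : Set.InjOn C F
    · exact hCn F (fun A hA => ((hF A).1 hA).1) hinj
    -- Two minimal sides of one cut are complementary, so a third minimal side, disjoint from both,
    -- cannot exist.
    · simp only [Set.InjOn] at hinj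
      push Not at hinj
      obtain ⟨A, hA, B, hB, hAB, hne⟩ := hinj
      have hA' := (hF A).1 hA
      have hB' := (hF B).1 hB
      have hc := (hcompl A B hAB).resolve_left hne
      have hsub : F ⊆ {A, B} := by
        intro D hD
        have hD' := (hF D).1 hD
        by_contra hh
        simp only [Finset.mem_insert, Finset.mem_singleton, not_or] at hh
        obtain ⟨x, hx⟩ := hD'.1.1
        have h1 := Finset.disjoint_left.1 (disjoint_of_minimal hk hD' hA' hh.1) hx
        have h2 := Finset.disjoint_left.1 (disjoint_of_minimal hk hD' hB' hh.2) hx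
        rw [hc, Finset.mem_compl] at h1
        exact h1 h2
      exact (Finset.card_le_card hsub).trans (Finset.card_le_two.trans hn)
  have hx : ∀ A : F, ∃ x, x ∈ A.1 := fun A => ((hF A.1).1 A.2).1.1
  choose x hx using hx
  refine ⟨F.attach.image x, Finset.card_image_le.trans (by simpa using hcard), fun A hA => ?_⟩
  obtain ⟨B, hBA, hB⟩ := exists_minimal_le_of_wellFoundedLT (N.IsMinCut k) A hA
  exact ⟨x ⟨B, (hF B).2 hB⟩, Finset.mem_inter.2 ⟨hBA (hx ⟨B, _⟩),
    Finset.mem_image_of_mem _ (Finset.mem_attach _ _)⟩⟩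

/-- A multigraph with at least five edges in each cut is orientable for each boundary if the sides
of cuts with exactly five edges have a transversal of at most five vertices. -/
lemma exists_orientation_of_transversal [Fintype E] [DecidableEq E] (s t : E → V) (γ : V → ℤ)
    (hγ : 3 ∣ ∑ v, γ v) [Nonempty V] (X : Finset V) (hX : X.card ≤ 5)
    (hcut : ∀ A : Finset V, A.Nonempty → A ≠ Finset.univ →
      6 ≤ (∑ e, if (s e ∈ A ↔ t e ∈ A) then (0 : ℤ) else 1) + (A ∩ X).card) :
    ∃ σ : E → ℤ, (∀ e, σ e = 1 ∨ σ e = -1) ∧ ∀ v, 3 ∣ (∑ e, σ e *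
      ((if s e = v then 1 else 0) - (if t e = v then 1 else 0))) - γ v := by
  let N : RootedNet V E :=
    { src := s, dst := t, edges := Finset.univ, verts := Finset.univ
      p := fun v => if v ∈ X then 1 else 0, q := fun _ => 0, γ := γ }
  have hN : N.Valid (Classical.arbitrary V) :=
    { closed := by simp [N]
      p_nonneg := fun v _ => by simp only [N]; split_ifs <;> simp
      q_nonneg := fun v _ => le_rfl
      sum_γ := hγ
      root := by
        have h1 : N.rootDeg = X.card := by simp [rootDeg, N]
        have h2 : N.rootBet = X.card := by simp [rootBet, N]
        rw [h1, h2]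
        unfold Small
        omega
      big := fun A _ hne hAS => by
        have h1 := hcut A hne hAS
        have h2 : N.deg A = (∑ e, if (s e ∈ A ↔ t e ∈ A) then (0 : ℤ) else 1) +
            (A ∩ X).card := by
          simp [deg, cut, cross, N, Finset.inter_comm]
        -- From degree 6 on, d ≥ 4 + |τ| holds for every boundary, since |τ| = 3 requires odd d.
        left
        rw [h2]
        unfold Big
        omega }
  obtain ⟨σ, hσ, hf⟩ := hN.exists_orientation
  refine ⟨σ, hσ, fun v => ?_⟩
  have := hf v (Finset.mem_univ v)
  simpa [flow, net, N] using this

end RootedNet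

/-! ### Return to multigraphs -/

namespace Graph

variable {α ε : Type*} {G : Graph α ε}

/-- A `k`-edge-connected multigraph has at least `k` edges in each cut. -/
lemma IsEdgeConnected.le_encard_edgeCut {k : ℕ} (h : G.IsEdgeConnected k) {X : Set α}
    {x y : α} (hxG : x ∈ V(G)) (hyG : y ∈ V(G)) (hx : x ∈ X) (hy : y ∉ X) :
    (k : ℕ∞) ≤ (G.edgeCut X).encard := by
  by_contra! hlt
  have hsub : G.edgeCut X ⊆ E(G) := fun e ⟨a, _, b, _, hl⟩ => hl.edge_mem
  -- Once the cut is deleted, no walk from `x` leaves `X`.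
  have key : ∀ z, Relation.ReflTransGen (G.deleteEdges (G.edgeCut X)).Adj x z → z ∈ X := by
    intro z hz
    induction hz with
    | refl => exact hx
    | tail _ hadj ih =>
      obtain ⟨e, he⟩ := hadj
      rw [deleteEdges_isLink] at he
      by_contra hb
      exact he.2 ⟨_, ih, _, hb, he.1⟩
  exact hy (key y ((h _ hsub hlt).2 x (by simpa using hxG) y (by simpa using hyG)))

lemma IsLink.mem_edgeCut_iff {e : ε} {a b : α} (h : G.IsLink e a b) (X : Set α) :
    e ∈ G.edgeCut X ↔ ¬ (a ∈ X ↔ b ∈ X) := by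
  constructor
  · rintro ⟨x, hx, y, hy, hl⟩
    rcases h.eq_and_eq_or_eq_and_eq hl with ⟨rfl, rfl⟩ | ⟨rfl, rfl⟩ <;> tauto
  · intro hne
    by_cases ha : a ∈ X
    · exact ⟨a, ha, b, by tauto, h⟩
    · exact ⟨b, by tauto, a, ha, h.symm⟩

/-- The integral form of the existence of orientations with a prescribed boundary. -/
lemma exists_sign_of_few_edgeCuts [Fintype V(G)] [Fintype E(G)] [DecidableEq V(G)]
    (hconn : G.IsEdgeConnected 5) (hcuts : {C : Set ε | G.IsEdgeCut 5 C}.encard ≤ 5)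
    (s t : E(G) → V(G)) (hst : ∀ e : E(G), G.IsLink e (s e) (t e)) (γ : V(G) → ℤ)
    (hγ : 3 ∣ ∑ v, γ v) :
    ∃ σ : E(G) → ℤ, (∀ e, σ e = 1 ∨ σ e = -1) ∧ ∀ v, 3 ∣ (∑ e, σ e *
      ((if s e = v then 1 else 0) - (if t e = v then 1 else 0))) - γ v := by
  classical
  let N : RootedNet V(G) E(G) :=
    { src := s, dst := t, edges := Finset.univ, verts := Finset.univ
      p := fun _ => 0, q := fun _ => 0, γ := γ }
  let C : Finset V(G) → Set ε := fun A => G.edgeCut (Subtype.val '' (A : Set V(G)))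
  have hmem : ∀ (A : Finset V(G)) (e : E(G)), e.1 ∈ C A ↔ ¬ (s e ∈ A ↔ t e ∈ A) := by
    intro A e
    simp only [C]
    rw [(hst e).mem_edgeCut_iff]
    simp
  have hcross : ∀ A e, N.cross A e = if e.1 ∈ C A then 1 else 0 := by
    intro A e
    rw [RootedNet.cross, ← ite_not]
    exact if_congr (hmem A e).symm rfl rfl
  have hC : ∀ A, C A = Subtype.val '' ((Finset.univ.filter fun e : E(G) => e.1 ∈ C A) :
      Set E(G)) := by
    intro A
    ext e
    simp only [Finset.coe_filter, Finset.mem_univ, true_and, Set.mem_image, Set.mem_ofPred_eq,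
      Subtype.exists, exists_and_left, exists_prop, exists_eq_right_right]
    refine ⟨fun h => ⟨h, ?_⟩, fun h => h.1⟩
    obtain ⟨x, _, y, _, hl⟩ := h
    exact hl.edge_mem
  have hcard : ∀ A, (C A).encard = ((Finset.univ.filter fun e : E(G) => e.1 ∈ C A).card : ℕ∞) := by
    intro A
    conv_lhs => rw [hC A]
    rw [Subtype.val_injective.encard_image, Set.encard_coe_eq_coe_finsetCard]
  have hcut : ∀ A, N.cut A = ((Finset.univ.filter fun e : E(G) => e.1 ∈ C A).card : ℤ) := by
    intro A
    rw [RootedNet.cut, Finset.sum_congr rfl fun e _ => hcross A e]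
    simp [N]
  have hfive : ∀ A : Finset V(G), A.Nonempty → A ≠ Finset.univ → 5 ≤ N.cut A := by
    rintro A ⟨x, hx⟩ hne
    obtain ⟨y, hy⟩ : ∃ y, y ∉ A := by
      by_contra! h
      exact hne (Finset.eq_univ_of_forall h)
    have h := hconn.le_encard_edgeCut (X := Subtype.val '' (A : Set V(G))) x.2 y.2
      (by simpa using hx) (by simpa using hy)
    change _ ≤ (C A).encard at h
    rw [hcard] at h
    rw [hcut]
    exact_mod_cast h
  obtain ⟨X, hX, hXA⟩ := N.exists_transversal (by norm_num) hfive (n := 5) (by norm_num) C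
    (fun A B hAB e => by rw [hcross, hcross, hAB]) (fun F hF hinj => by
      have h1 : C '' F ⊆ {C : Set ε | G.IsEdgeCut 5 C} := by
        rintro _ ⟨A, hA, rfl⟩
        refine ⟨⟨_, by rintro _ ⟨v, _, rfl⟩; exact v.2, rfl⟩, ?_⟩
        have h := (hF A hA).2.2
        change (C A).encard = _
        rw [hcut] at h
        rw [hcard]
        exact_mod_cast h
      have h2 := (Set.encard_le_encard h1).trans hcuts
      rw [hinj.encard_image, Set.encard_coe_eq_coe_finsetCard] at h2
      exact_mod_cast h2)
  have : Nonempty V(G) := by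
    obtain ⟨x, hx⟩ := (hconn ∅ (Set.empty_subset _) (by simp)).1
    exact ⟨⟨x, by simpa using hx⟩⟩
  refine RootedNet.exists_orientation_of_transversal s t γ hγ X hX fun A hne hAS => ?_
  change 6 ≤ N.cut A + _
  have h1 := hfive A hne hAS
  -- Where only five edges cross, a transversal vertex in `A` supplies the sixth.
  by_cases h2 : N.cut A = 5
  · have := Finset.card_pos.2 (hXA A ⟨hne, hAS, h2⟩)
    omega
  · omega

lemma exists_isBoundaryOrientation_of_few_edgeCuts [Fintype V(G)] [Fintype E(G)]
    (hconn : G.IsEdgeConnected 5) (hcuts : {C : Set ε | G.IsEdgeCut 5 C}.encard ≤ 5)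
    (b : V(G) → ZMod 3) (hb : G.IsBoundary 3 b) :
    ∃ D : G.Orientation, D.IsBoundaryOrientation b := by
  classical
  have hends : ∀ e : E(G), ∃ x y : V(G), G.IsLink e x y := by
    intro e
    obtain ⟨x, y, h⟩ := G.exists_isLink_of_mem_edgeSet e.2
    exact ⟨⟨x, h.left_mem⟩, ⟨y, h.right_mem⟩, h⟩
  choose s t hst using hends
  obtain ⟨σ, hσ, hf⟩ := exists_sign_of_few_edgeCuts hconn hcuts s t hst (fun v => (b v).val) <| by
    rw [← Nat.cast_three, ← ZMod.intCast_zmod_eq_zero_iff_dvd]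
    have : ∑ v, b v = 0 := hb
    simpa using this
  refine ⟨{ tail := fun e => if σ e = 1 then s e else t e
            head := fun e => if σ e = 1 then t e else s e
            isLink := fun e => ?_ }, fun v => ?_⟩
  · split_ifs
    exacts [hst e, (hst e).symm]
  · have h := hf v
    rw [← Nat.cast_three, ← ZMod.intCast_zmod_eq_zero_iff_dvd] at h
    push_cast at h
    rw [ZMod.natCast_zmod_val, sub_eq_zero] at h
    rw [← h, Orientation.outArcs, Orientation.inArcs, Finset.card_filter, Finset.card_filter]
    push_cast
    rw [← Finset.sum_sub_distrib]
    refine Finset.sum_congr rfl fun e _ => ?_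
    rcases hσ e with h | h <;> simp [h]

lemma Orientation.IsBoundaryOrientation.exists_nowhere_zero [Fintype E(G)] {D : G.Orientation}
    {b : V(G) → ZMod 3} (h : D.IsBoundaryOrientation b) :
    ∃ f : E(G) → ZMod 3, (∀ e, f e ≠ 0) ∧
      ∀ v, ∑ e ∈ D.outArcs v, f e - ∑ e ∈ D.inArcs v, f e = b v :=
  ⟨fun _ => 1, fun _ => one_ne_zero, fun v => by simpa using h v⟩

end Graph

theorem theorem1p17 {α ε : Type*} (G : Graph α ε) [Fintype V(G)] [Fintype E(G)]
    (hloopless : G.Loopless) (hconn : G.IsEdgeConnected 5)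
    (hcuts : {C : Set ε | G.IsEdgeCut 5 C}.encard ≤ 5) :
    G.IsZConnected 3 ∧
      ∀ b : V(G) → ZMod 3, G.IsBoundary 3 b →
        ∃ D : G.Orientation, D.IsBoundaryOrientation b := by
  have key := Graph.exists_isBoundaryOrientation_of_few_edgeCuts hconn hcuts
  refine ⟨fun b hb => ?_, key⟩
  obtain ⟨D, hD⟩ := key b hb
  exact ⟨D, hD.exists_nowhere_zero⟩
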